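/- Let $\lambda$ be a partition of $N$. A tableau of shape $\lambda$ is a bijective filling of the Young diagram of $\lambda$ with $\{1,\dots,N\}$. Let $M^\lambda$ be the complex vector space generated by the tableaux of shape $\lambda$ subject to the relations $t+s=0$ whenever $s$ is obtained from $t$ by switching two entries in the same column; write $[t]$ for the class of $t$. The symmetric group $\mathfrak S_N$ acts on $M^\lambda$ by acting on the entries. For a tableau $t$ with row stabilizer $R_t$ and column stabilizer $C_t$ let $e_t=\sum_{\alpha\in R_t}\alpha\,\sum_{\beta\in C_t}\operatorname{sgn}(\beta)\beta\in\mathbb C\mathfrak S_N$; the Specht module $S^\lambda$ is the submodule of the regular representation $\mathbb C\mathfrak S_N$ spanned by $\{\tau e_t:\tau\in\mathfrak S_N\}$, for any tableau $t$ of shape $\lambda$. Let $1\le \ell\le m\le n$ and $\mu=2^m1^{n-m}$, a shape with two columns, of lengths $n$ and $m$. Let $\eta_\ell: M^\mu\to M^\mu$ be the linear map $$\eta_\ell[t]=\binom m\ell[t]-\sum[s],$$ where the sum ranges over all tableaux $s$ obtained from $t$ by choosing $\ell$ positions in the first column and $\ell$ positions in the second column and swapping the entries in the chosen positions, preserving the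 vertical order of each of the two sets of $\ell$ entries. **Theorem.** For every $0\le i\le m$, the representation $M^\mu$ of $\mathfrak S_{n+m}$ has exactly one submodule isomorphic to $S^{2^i1^{n+m-2i}}$. This submodule is irreducible, and $\eta_\ell$ acts on it as multiplication by the scalar $$\omega_{\ell,i}=\binom m\ell-\sum_{\ell_1=0}^{\ell}\binom{m-i}{\ell_1}\binom{n-i}{\ell_1}\binom{i}{\ell-\ell_1}(-1)^{\ell_1}.$$ -/

import Mathlib

/-! Tableaux, column tabloids, Specht modules, and the operator `η_ℓ` on two-column tabloids.
Letters are `Fin N`, and the symmetric group `𝔖_N` is `Equiv.Perm (Fin N)`. -/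

noncomputable section

namespace SpechtPres

open Equiv

/-- A Young tableau of shape `lam`: a bijective filling of the cells (pairs `(row, column)`) with
the letters `Fin N`. There is one exactly when `lam` has `N` cells. -/
abbrev Tableau (lam : YoungDiagram) (N : ℕ) : Type := {c : ℕ × ℕ // c ∈ lam.cells} ≃ Fin N

namespace Tableau

variable {lam : YoungDiagram} {N : ℕ}

/-- The row stabilizer `R_t`: permutations of the letters that keep each letter in its row. -/
def rowStabilizer (t : Tableau lam N) : Subgroup (Perm (Fin N)) where
  carrier := {σ | ∀ x, (t.symm (σ x)).1.1 = (t.symm x).1.1}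
  mul_mem' := fun {σ τ} hσ hτ x => (hσ (τ x)).trans (hτ x)
  one_mem' := fun _ => rfl
  inv_mem' := fun {σ} hσ x => by simpa using (hσ (σ⁻¹ x)).symm

/-- The column stabilizer `C_t`: permutations of the letters that keep each letter in its
column. -/
def colStabilizer (t : Tableau lam N) : Subgroup (Perm (Fin N)) where
  carrier := {σ | ∀ x, (t.symm (σ x)).1.2 = (t.symm x).1.2}
  mul_mem' := fun {σ τ} hσ hτ x => (hσ (τ x)).trans (hτ x)
  one_mem' := fun _ => rfl
  inv_mem' := fun {σ} hσ x => by simpa using (hσ (σ⁻¹ x)).symm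

open Classical in
/-- The Young symmetrizer `e_t = (∑_{α ∈ R_t} α) (∑_{β ∈ C_t} sgn(β) β)` in `ℂ𝔖_N`. -/
def symmetrizer (t : Tableau lam N) : MonoidAlgebra ℂ (Perm (Fin N)) :=
  (∑ α : t.rowStabilizer, MonoidAlgebra.of ℂ (Perm (Fin N)) α) *
    ∑ β : t.colStabilizer,
      ((Perm.sign (β : Perm (Fin N)) : ℤ) : ℂ) • MonoidAlgebra.of ℂ (Perm (Fin N)) β

end Tableau

/-- The (left) regular representation of `𝔖_N` on its group algebra. -/
def regularRep (N : ℕ) :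
    Representation ℂ (Perm (Fin N)) (MonoidAlgebra ℂ (Perm (Fin N))) :=
  ((Algebra.lmul ℂ (MonoidAlgebra ℂ (Perm (Fin N)))).toMonoidHom).comp
    (MonoidAlgebra.of ℂ (Perm (Fin N)))

/-- The Specht module `S^lam`: the subrepresentation of the regular representation spanned by
the elements `τ e_t`, `τ ∈ 𝔖_N`, for a tableau `t` of shape `lam`. -/
def specht {lam : YoungDiagram} {N : ℕ} (t : Tableau lam N) : Subrepresentation (regularRep N) where
  toSubmodule := Submodule.span ℂ
    (Set.range fun τ : Perm (Fin N) => MonoidAlgebra.of ℂ (Perm (Fin N)) τ * t.symmetrizer)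
  apply_mem_toSubmodule := by
    intro g v hv
    induction hv using Submodule.span_induction with
    | mem x hx =>
      obtain ⟨τ, rfl⟩ := hx
      refine Submodule.subset_span ⟨g * τ, ?_⟩
      simp only [map_mul, mul_assoc]
      rfl
    | zero => simp
    | add x y _ _ hx hy => rw [map_add]; exact add_mem hx hy
    | smul a x _ hx => rw [map_smul]; exact Submodule.smul_mem _ _ hx

section ColumnTabloids

variable {lam : YoungDiagram} {N : ℕ}

/-- The span of the column relations `t + s`, where `s` is obtained from `t` by switching the
entries of two distinct cells of the same column. -/
def columnRelations (lam : YoungDiagram) (N : ℕ) : Submodule ℂ (Tableau lam N →₀ ℂ) :=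
  Submodule.span ℂ {x | ∃ (t : Tableau lam N) (c d : {c : ℕ × ℕ // c ∈ lam.cells}),
    c ≠ d ∧ c.1.2 = d.1.2 ∧ x = Finsupp.single t 1 + Finsupp.single ((swap c d).trans t) 1}

/-- The space `M^lam` of column tabloids. -/
abbrev ColumnTabloids (lam : YoungDiagram) (N : ℕ) : Type :=
  (Tableau lam N →₀ ℂ) ⧸ columnRelations lam N

/-- The column tabloid `[t]`. -/
def tabloid (t : Tableau lam N) : ColumnTabloids lam N :=
  (columnRelations lam N).mkQ (Finsupp.single t 1)

/-- The action of a permutation of the letters on formal combinations of tableaux. -/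
def letterAction (lam : YoungDiagram) (N : ℕ) (σ : Perm (Fin N)) :
    (Tableau lam N →₀ ℂ) →ₗ[ℂ] (Tableau lam N →₀ ℂ) :=
  Finsupp.lmapDomain ℂ ℂ fun t => t.trans σ

theorem letterAction_single (σ : Perm (Fin N)) (t : Tableau lam N) (a : ℂ) :
    letterAction lam N σ (Finsupp.single t a) = Finsupp.single (t.trans σ) a :=
  Finsupp.mapDomain_single

theorem columnRelations_le_comap (σ : Perm (Fin N)) :
    columnRelations lam N ≤ (columnRelations lam N).comap (letterAction lam N σ) := by
  refine Submodule.span_le.2 ?_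
  rintro x ⟨t, c, d, hcd, hcol, rfl⟩
  refine Submodule.subset_span ⟨t.trans σ, c, d, hcd, hcol, ?_⟩
  rw [map_add, letterAction_single, letterAction_single]
  rfl

/-- The representation of `𝔖_N` on `M^lam`, given by `σ [t] = [σ t]`. -/
def columnTabloidRep (lam : YoungDiagram) (N : ℕ) :
    Representation ℂ (Perm (Fin N)) (ColumnTabloids lam N) where
  toFun σ := (columnRelations lam N).mapQ (columnRelations lam N) (letterAction lam N σ)
    (columnRelations_le_comap σ)
  map_one' := by
    refine Submodule.linearMap_qext _ (Finsupp.lhom_ext fun t a => ?_)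
    change (columnRelations lam N).mkQ (letterAction lam N 1 (Finsupp.single t a)) = _
    rw [letterAction_single]
    rfl
  map_mul' σ τ := by
    refine Submodule.linearMap_qext _ (Finsupp.lhom_ext fun t a => ?_)
    change (columnRelations lam N).mkQ (letterAction lam N (σ * τ) (Finsupp.single t a)) =
      (columnRelations lam N).mkQ
        (letterAction lam N σ (letterAction lam N τ (Finsupp.single t a)))
    simp only [letterAction_single]
    rfl

theorem columnTabloidRep_tabloid (σ : Perm (Fin N)) (t : Tableau lam N) :
    columnTabloidRep lam N σ (tabloid t) = tabloid (t.trans σ) := by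
  change (columnRelations lam N).mkQ (letterAction lam N σ (Finsupp.single t 1)) = _
  rw [letterAction_single]
  rfl

theorem tabloid_swap (t : Tableau lam N) {c d : {c : ℕ × ℕ // c ∈ lam.cells}} (hcd : c ≠ d)
    (hcol : c.1.2 = d.1.2) : tabloid ((swap c d).trans t) = -tabloid t := by
  rw [eq_neg_iff_add_eq_zero, add_comm]
  change (columnRelations lam N).mkQ _ + (columnRelations lam N).mkQ _ = 0
  rw [← map_add, Submodule.mkQ_apply, Submodule.Quotient.mk_eq_zero]
  exact Submodule.subset_span ⟨t, c, d, hcd, hcol, rfl⟩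

/-- Rearranging the cells inside the columns multiplies a column tabloid by the sign. -/
theorem tabloid_trans_of_col (π : Perm {c : ℕ × ℕ // c ∈ lam.cells})
    (hπ : ∀ c, (π c).1.2 = c.1.2) (t : Tableau lam N) :
    tabloid (π.trans t) = ((Perm.sign π : ℤ) : ℂ) • tabloid t := by
  induction h : π.support.card using Nat.strong_induction_on generalizing π t with
  | _ k ih =>
    by_cases h1 : ∃ x, π x ≠ x
    · obtain ⟨x, hx⟩ := h1
      subst h
      have hcard := Perm.card_support_swap_mul hx
      have hcol : ∀ c, ((swap x (π x) * π) c).1.2 = c.1.2 := by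
        intro c
        rw [← hπ c, Perm.mul_apply, swap_apply_def]
        split_ifs with h1 h2
        · rw [h1, hπ]
        · rw [h2, hπ]
        · rfl
      have key := ih _ hcard (swap x (π x) * π) hcol ((swap x (π x)).trans t) rfl
      have e : (swap x (π x) * π).trans ((swap x (π x)).trans t) = π.trans t := by
        ext c
        simp [Equiv.trans_apply, Perm.mul_apply]
      rw [e, tabloid_swap t hx.symm (hπ x).symm, Perm.sign_mul, Perm.sign_swap hx.symm] at key
      simpa using key
    · push Not at h1
      obtain rfl : π = 1 := Equiv.ext h1
      simp only [Perm.sign_one, Units.val_one, Int.cast_one, one_smul]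
      rfl

end ColumnTabloids

section Exchange

variable {X : Type*} [DecidableEq X]

/-- The permutation exchanging `a k` with `b k` for every `k`. -/
def exchange {ℓ : ℕ} (a b : Fin ℓ → X) : Perm X :=
  (List.ofFn fun k => swap (a k) (b k)).prod

theorem exchange_succ {ℓ : ℕ} (a b : Fin (ℓ + 1) → X) :
    exchange a b = swap (a 0) (b 0) * exchange (fun k => a k.succ) (fun k => b k.succ) := by
  simp [exchange, List.ofFn_succ]

theorem exchange_of_ne {ℓ : ℕ} {a b : Fin ℓ → X} {x : X} (ha : ∀ k, x ≠ a k)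
    (hb : ∀ k, x ≠ b k) : exchange a b x = x := by
  induction ℓ with
  | zero => simp [exchange]
  | succ ℓ ih =>
    rw [exchange_succ, Perm.mul_apply, ih (fun k => ha _) (fun k => hb _),
      swap_apply_of_ne_of_ne (ha 0) (hb 0)]

theorem exchange_left {ℓ : ℕ} {a b : Fin ℓ → X} (ha : Function.Injective a)
    (hb : Function.Injective b) (hab : ∀ j k, a j ≠ b k) (k : Fin ℓ) :
    exchange a b (a k) = b k := by
  induction ℓ with
  | zero => exact k.elim0
  | succ ℓ ih =>
    rw [exchange_succ, Perm.mul_apply]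
    induction k using Fin.cases with
    | zero =>
      rw [exchange_of_ne (fun k => ha.ne (Fin.succ_ne_zero k).symm) (fun k => hab _ _),
        swap_apply_left]
    | succ k =>
      have h := ih (a := fun k => a k.succ) (b := fun k => b k.succ)
        (ha.comp (Fin.succ_injective _)) (hb.comp (Fin.succ_injective _)) (fun j k => hab _ _) k
      rw [h, swap_apply_of_ne_of_ne (hab _ _).symm
        (hb.ne (Fin.succ_ne_zero k))]

theorem exchange_comm {ℓ : ℕ} (a b : Fin ℓ → X) : exchange a b = exchange b a := by
  simp only [exchange, swap_comm]

theorem exchange_right {ℓ : ℕ} {a b : Fin ℓ → X} (ha : Function.Injective a)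
    (hb : Function.Injective b) (hab : ∀ j k, a j ≠ b k) (k : Fin ℓ) :
    exchange a b (b k) = a k := by
  rw [exchange_comm]
  exact exchange_left hb ha (fun j k => (hab k j).symm) k

theorem sign_exchange [Fintype X] {ℓ : ℕ} {a b : Fin ℓ → X} (hab : ∀ k, a k ≠ b k) :
    Perm.sign (exchange a b) = (-1) ^ ℓ := by
  induction ℓ with
  | zero => simp [exchange]
  | succ ℓ ih =>
    rw [exchange_succ, Perm.sign_mul, Perm.sign_swap (hab 0), ih (fun k => hab _), pow_succ']

theorem mul_exchange {ℓ : ℕ} (s : Perm X) (a b : Fin ℓ → X) :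
    s * exchange a b = exchange (s ∘ a) (s ∘ b) * s := by
  induction ℓ with
  | zero => simp [exchange]
  | succ ℓ ih =>
    rw [exchange_succ, exchange_succ, ← mul_assoc, Equiv.mul_swap_eq_swap_mul, mul_assoc, ih,
      mul_assoc]
    rfl

end Exchange

section TwoColumns

/-- The Young diagram of the partition `2^p 1^q`: the first column has the cells
`(0,0), …, (p+q-1,0)` and the second one the cells `(0,1), …, (p-1,1)`. -/
def twoOne (p q : ℕ) : YoungDiagram where
  cells := Finset.range (p + q) ×ˢ {0} ∪ Finset.range p ×ˢ {1}
  isLowerSet := by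
    rintro ⟨r, c⟩ ⟨r', c'⟩ ⟨h1, h2⟩ h
    simp only [Finset.coe_union, Finset.coe_product, Set.mem_union, Set.mem_prod,
      Finset.mem_coe, Finset.mem_range, Finset.mem_singleton] at *
    omega

variable {p q : ℕ}

/-- The cell in row `r` of the first column. -/
def leftCell (r : Fin (p + q)) : {c : ℕ × ℕ // c ∈ (twoOne p q).cells} :=
  ⟨(r, 0), by simp [twoOne]⟩

/-- The cell in row `r` of the second column. -/
def rightCell (r : Fin p) : {c : ℕ × ℕ // c ∈ (twoOne p q).cells} :=
  ⟨(r, 1), by simp [twoOne]⟩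

theorem leftCell_injective : Function.Injective (leftCell : Fin (p + q) → _) := by
  intro r s h
  simpa [leftCell, Fin.ext_iff] using h

theorem rightCell_injective :
    Function.Injective (rightCell : Fin p → {c : ℕ × ℕ // c ∈ (twoOne p q).cells}) := by
  intro r s h
  simpa [rightCell, Fin.ext_iff] using h

theorem leftCell_ne_rightCell (r : Fin (p + q)) (s : Fin p) : leftCell r ≠ rightCell s := by
  intro h
  simpa [leftCell, rightCell] using congrArg (fun c => c.1.2) h

theorem cell_cases (c : {c : ℕ × ℕ // c ∈ (twoOne p q).cells}) :
    (∃ r, c = leftCell r) ∨ ∃ r, c = rightCell r := by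
  obtain ⟨⟨r, k⟩, h⟩ := c
  have h' := h
  simp only [twoOne, Finset.mem_union, Finset.mem_product, Finset.mem_range,
    Finset.mem_singleton] at h'
  obtain ⟨hr, rfl⟩ | ⟨hr, rfl⟩ := h'
  · exact Or.inl ⟨⟨r, hr⟩, rfl⟩
  · exact Or.inr ⟨⟨r, hr⟩, rfl⟩

/-- The tableau obtained from `t` by swapping, for every `k`, the entry in row `a k` of the first
column with the entry in row `b k` of the second column. -/
def swapEntries {N ℓ : ℕ} (t : Tableau (twoOne p q) N) (a : Fin ℓ → Fin (p + q))
    (b : Fin ℓ → Fin p) : Tableau (twoOne p q) N :=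
  (exchange (fun k => leftCell (a k)) (fun k => rightCell (b k))).trans t

theorem exchange_cell {ℓ : ℕ} {a : Fin ℓ → Fin (p + q)} {b : Fin ℓ → Fin p}
    (ha : Function.Injective a) (hb : Function.Injective b)
    (x : {c : ℕ × ℕ // c ∈ (twoOne p q).cells}) :
    let E := exchange (fun k => leftCell (a k)) (fun k => rightCell (b k))
    let P := fun c : {c : ℕ × ℕ // c ∈ (twoOne p q).cells} =>
      (∃ r ∈ Set.range a, c = leftCell r) ∨ ∃ r ∈ Set.range b, c = rightCell r
    (P x ∧ P (E x) ∧ x.1.2 + (E x).1.2 = 1) ∨ (¬ P x ∧ E x = x) := by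
  intro E P
  by_cases hx : P x
  · refine Or.inl ⟨hx, ?_⟩
    obtain ⟨_, ⟨k, rfl⟩, rfl⟩ | ⟨_, ⟨k, rfl⟩, rfl⟩ := hx
    · have h : E (leftCell (a k)) = rightCell (b k) :=
        exchange_left (leftCell_injective.comp ha) (rightCell_injective.comp hb)
          (fun _ _ => leftCell_ne_rightCell _ _) k
      rw [h]
      exact ⟨Or.inr ⟨_, ⟨k, rfl⟩, rfl⟩, rfl⟩
    · have h : E (rightCell (b k)) = leftCell (a k) :=
        exchange_right (leftCell_injective.comp ha) (rightCell_injective.comp hb)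
          (fun _ _ => leftCell_ne_rightCell _ _) k
      rw [h]
      exact ⟨Or.inl ⟨_, ⟨k, rfl⟩, rfl⟩, rfl⟩
  · refine Or.inr ⟨hx, exchange_of_ne (fun k h => hx ?_) (fun k h => hx ?_)⟩
    · exact Or.inl ⟨_, ⟨k, rfl⟩, h⟩
    · exact Or.inr ⟨_, ⟨k, rfl⟩, h⟩

/-- The column tabloid after an exchange depends only on the two sets of exchanged rows. -/
theorem tabloid_swapEntries_congr {N ℓ : ℕ} (t : Tableau (twoOne p q) N)
    {a a' : Fin ℓ → Fin (p + q)} {b b' : Fin ℓ → Fin p} (ha : Function.Injective a)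
    (ha' : Function.Injective a') (hb : Function.Injective b) (hb' : Function.Injective b')
    (haa : Set.range a = Set.range a') (hbb : Set.range b = Set.range b') :
    tabloid (swapEntries t a b) = tabloid (swapEntries t a' b') := by
  set E := exchange (fun k => leftCell (a k))
    (fun k => (rightCell (b k) : {c : ℕ × ℕ // c ∈ (twoOne p q).cells})) with hE
  set E' := exchange (fun k => leftCell (a' k))
    (fun k => (rightCell (b' k) : {c : ℕ × ℕ // c ∈ (twoOne p q).cells})) with hE'
  have hcol : ∀ c, ((E'⁻¹ * E) c).1.2 = c.1.2 := by
    intro c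
    have hy : E' ((E'⁻¹ * E) c) = E c := by simp
    generalize (E'⁻¹ * E) c = y at hy
    have h1 := exchange_cell ha hb c
    have h2 := exchange_cell ha' hb' y
    simp only [← hE, ← hE', haa, hbb, hy] at h1 h2
    rcases h1 with ⟨p1, p2, p3⟩ | ⟨p1, p2⟩ <;> rcases h2 with ⟨r1, r2, r3⟩ | ⟨r1, r2⟩
    · omega
    · rw [r2] at p2
      exact absurd p2 r1
    · rw [p2] at r2
      exact absurd r2 p1
    · rw [← r2, p2]
  have hs : Perm.sign (E'⁻¹ * E) = 1 := by
    rw [Perm.sign_mul, Perm.sign_inv, hE, hE',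
      sign_exchange (fun _ => leftCell_ne_rightCell _ _),
      sign_exchange (fun _ => leftCell_ne_rightCell _ _), Int.units_mul_self]
  have key := tabloid_trans_of_col (E'⁻¹ * E) hcol (swapEntries t a' b')
  rw [hs] at key
  have e : (E'⁻¹ * E).trans (swapEntries t a' b') = swapEntries t a b := by
    apply Equiv.ext
    intro c
    change t (E' ((E'⁻¹ * E) c)) = t (E c)
    simp
  rw [e] at key
  simpa using key

theorem exists_orderEmbedding_range {ℓ n : ℕ} {f : Fin ℓ → Fin n} (hf : Function.Injective f) :
    ∃ a : Fin ℓ ↪o Fin n, Set.range a = Set.range f := by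
  have h : (Finset.univ.image f).card = ℓ := by
    rw [Finset.card_image_of_injective _ hf, Finset.card_univ, Fintype.card_fin]
  exact ⟨(Finset.univ.image f).orderEmbOfFin h, by simp⟩

theorem sum_orderEmbedding_perm {ℓ n : ℕ} {A : Type*} [AddCommMonoid A]
    (F : (Fin ℓ → Fin n) → A)
    (hF : ∀ f g : Fin ℓ → Fin n, Function.Injective f → Function.Injective g →
      Set.range f = Set.range g → F f = F g) (ρ : Perm (Fin n)) :
    ∑ a : Fin ℓ ↪o Fin n, F (ρ ∘ a) = ∑ a : Fin ℓ ↪o Fin n, F a := by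
  choose Φ hΦ using fun a : Fin ℓ ↪o Fin n =>
    exists_orderEmbedding_range (ρ.injective.comp a.injective)
  have hinj : Function.Injective Φ := by
    intro a a' h
    have h' : Set.range (ρ ∘ a) = Set.range (ρ ∘ a') := by rw [← hΦ, ← hΦ, h]
    rw [Set.range_comp, Set.range_comp] at h'
    exact OrderEmbedding.range_inj.1 (ρ.injective.image_injective h')
  refine Fintype.sum_bijective Φ (Finite.injective_iff_bijective.1 hinj) _ _ fun a => ?_
  exact hF _ _ (ρ.injective.comp a.injective) (Φ a).injective (hΦ a).symm

/-- The value `C(p,ℓ) [t] - ∑ [s]` of `η_ℓ` at a tableau `t` of shape `2^p 1^q`. The sum is over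
all choices of `ℓ` rows `a 0 < a 1 < ⋯` of the first column and `ℓ` rows `b 0 < b 1 < ⋯` of the
second column; `s` is obtained by swapping the chosen entries, preserving vertical order. -/
def etaTableau {N : ℕ} (ℓ : ℕ) (t : Tableau (twoOne p q) N) : ColumnTabloids (twoOne p q) N :=
  (p.choose ℓ : ℂ) • tabloid t -
    ∑ a : Fin ℓ ↪o Fin (p + q), ∑ b : Fin ℓ ↪o Fin p, tabloid (swapEntries t a b)

theorem tabloid_swapEntries_swap_left {N ℓ : ℕ} (t : Tableau (twoOne p q) N)
    {r r' : Fin (p + q)} (hr : r ≠ r') (a : Fin ℓ → Fin (p + q)) (b : Fin ℓ → Fin p) :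
    tabloid (swapEntries ((swap (leftCell r) (leftCell r')).trans t) a b) =
      -tabloid (swapEntries t (swap r r' ∘ a) b) := by
  have h := mul_exchange (swap (leftCell r) (leftCell r')) (fun k => leftCell (a k))
    (fun k => (rightCell (b k) : {c : ℕ × ℕ // c ∈ (twoOne p q).cells}))
  have h1 : (swap (leftCell r) (leftCell r') ∘ fun k => leftCell (a k)) =
      fun k => leftCell ((swap r r' ∘ a) k) := by
    funext k
    exact leftCell_injective.swap_apply r r' (a k)
  have h2 : (swap (leftCell r) (leftCell r') ∘ fun k => rightCell (b k)) =
      fun k => rightCell (b k) := by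
    funext k
    exact swap_apply_of_ne_of_ne (leftCell_ne_rightCell _ _).symm (leftCell_ne_rightCell _ _).symm
  rw [h1, h2] at h
  rw [← tabloid_swap _ (leftCell_injective.ne hr) rfl]
  congr 1
  apply Equiv.ext
  intro c
  exact congrArg t (Equiv.congr_fun h c)

theorem tabloid_swapEntries_swap_right {N ℓ : ℕ} (t : Tableau (twoOne p q) N)
    {r r' : Fin p} (hr : r ≠ r') (a : Fin ℓ → Fin (p + q)) (b : Fin ℓ → Fin p) :
    tabloid (swapEntries ((swap (rightCell r) (rightCell r')).trans t) a b) =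
      -tabloid (swapEntries t a (swap r r' ∘ b)) := by
  have h := mul_exchange (swap (rightCell r) (rightCell r')) (fun k => leftCell (a k))
    (fun k => (rightCell (b k) : {c : ℕ × ℕ // c ∈ (twoOne p q).cells}))
  have h1 : (swap (rightCell r) (rightCell r') ∘ fun k => rightCell (b k)) =
      fun k => (rightCell ((swap r r' ∘ b) k) : {c : ℕ × ℕ // c ∈ (twoOne p q).cells}) := by
    funext k
    exact rightCell_injective.swap_apply r r' (b k)
  have h2 : (swap (rightCell r) (rightCell r') ∘ fun k => leftCell (a k)) =
      fun k => leftCell (a k) := by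
    funext k
    exact swap_apply_of_ne_of_ne (leftCell_ne_rightCell _ _) (leftCell_ne_rightCell _ _)
  rw [h1, h2] at h
  rw [← tabloid_swap _ (rightCell_injective.ne hr) rfl]
  congr 1
  apply Equiv.ext
  intro c
  exact congrArg t (Equiv.congr_fun h c)

theorem etaTableau_swap {N : ℕ} (ℓ : ℕ) (t : Tableau (twoOne p q) N)
    {c d : {c : ℕ × ℕ // c ∈ (twoOne p q).cells}} (hcd : c ≠ d) (hcol : c.1.2 = d.1.2) :
    etaTableau ℓ ((swap c d).trans t) = -etaTableau ℓ t := by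
  have hsum : ∑ a : Fin ℓ ↪o Fin (p + q), ∑ b : Fin ℓ ↪o Fin p,
      tabloid (swapEntries ((swap c d).trans t) a b) =
      -∑ a : Fin ℓ ↪o Fin (p + q), ∑ b : Fin ℓ ↪o Fin p, tabloid (swapEntries t a b) := by
    obtain ⟨r, rfl⟩ | ⟨r, rfl⟩ := cell_cases c <;> obtain ⟨r', rfl⟩ | ⟨r', rfl⟩ := cell_cases d
    · have hr : r ≠ r' := fun h => hcd (by rw [h])
      simp only [tabloid_swapEntries_swap_left t hr, Finset.sum_neg_distrib]
      congr 1
      refine sum_orderEmbedding_perm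
        (fun f => ∑ b : Fin ℓ ↪o Fin p, tabloid (swapEntries t f b)) ?_ (swap r r')
      intro f g hf hg hfg
      exact Finset.sum_congr rfl fun b _ =>
        tabloid_swapEntries_congr t hf hg b.injective b.injective hfg rfl
    · exact absurd hcol (by simp [leftCell, rightCell])
    · exact absurd hcol (by simp [leftCell, rightCell])
    · have hr : r ≠ r' := fun h => hcd (by rw [h])
      simp only [tabloid_swapEntries_swap_right t hr, Finset.sum_neg_distrib]
      congr 1
      refine Finset.sum_congr rfl fun a _ => ?_
      refine sum_orderEmbedding_perm (fun f => tabloid (swapEntries t a f)) ?_ (swap r r')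
      intro f g hf hg hfg
      exact tabloid_swapEntries_congr t a.injective a.injective hf hg rfl hfg
  rw [etaTableau, etaTableau, hsum, tabloid_swap t hcd hcol, smul_neg]
  abel

/-- The operator `η_ℓ` on `M^μ` for `μ = 2^p 1^q`: the linear map with `η_ℓ [t] = etaTableau ℓ t`
for every tableau `t`. -/
def eta (p q N ℓ : ℕ) : ColumnTabloids (twoOne p q) N →ₗ[ℂ] ColumnTabloids (twoOne p q) N :=
  (columnRelations (twoOne p q) N).liftQ (Finsupp.linearCombination ℂ (etaTableau ℓ)) (by
    refine Submodule.span_le.2 ?_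
    rintro x ⟨t, c, d, hcd, hcol, rfl⟩
    simp [etaTableau_swap ℓ t hcd hcol])

theorem eta_tabloid {N : ℕ} (ℓ : ℕ) (t : Tableau (twoOne p q) N) :
    eta p q N ℓ (tabloid t) = etaTableau ℓ t := by
  change Finsupp.linearCombination ℂ (etaTableau ℓ) (Finsupp.single t 1) = _
  simp

/-- The scalar `ω_{ℓ,i}` for the shape with columns of lengths `n` and `m`. All the natural number
subtractions are exact when `i ≤ m ≤ n`. -/
def omega (n m ℓ i : ℕ) : ℤ :=
  (m.choose ℓ : ℤ) - ∑ k ∈ Finset.range (ℓ + 1),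
    ((m - i).choose k : ℤ) * ((n - i).choose k : ℤ) * (i.choose (ℓ - k) : ℤ) * (-1) ^ k

end TwoColumns

end SpechtPres

end

/-! Fix `t` of shape `2^i 1^{n+m-2i}` and write `a` and `b` for its row sum and signed column sum,
so that `e_t = ab`. Choose a tableau `s₀` of shape `2^m 1^{n-m}` that has the letters of the
two-cell rows of `t` in the same cells (`Agrees`).

Everything rests on a straightening argument, `exists_fixesPairs`. Let `F` be a function of tableaux
that changes sign under switches within a column and is invariant under `R_t`. Switches and row
transpositions bring the letters of the two-cell rows of `t` back to their places in `s₀`, unless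
two letters of one row share a column, and then `F` vanishes. What remains is a permutation `β` of
the other letters. It lies in `C_t` and commutes with `R_t`, so `ba β = sgn(β) ba`. For `F s =
ba[s]` this shows that `ba` maps all of `M^μ` into the line of `ba[s₀]`. For `s₀ = t` the same
argument gives von Neumann's relation `a x b ∈ ℂ ab`.

Irreducibility of the Specht module follows from this relation and from the positive definite
Hermitian form on `ℂ𝔖_N`, for which `a` and `b` are self-adjoint up to no scalar at all: the form
excludes `(ab)² = 0` and nonzero submodules killed by `ab`.

Existence: the coefficient of `[s₀]` in `ab[s₀]` is a positive integer, so `x ↦ x[s₀]` is nonzero on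
`S^λ`, hence injective. Uniqueness: `e_t² = a(ba)b` is a nonzero multiple of `e_t`, so every
intertwining map sends `e_t` into the line of `aba[s₀]`, and this vector generates every copy.

Eigenvalue: `η_ℓ` commutes with the group, so it suffices to apply `ba` to `η_ℓ[s₀]`. An exchange of
row sets `S` and `T` contributes zero unless `S` and `T` have the same trace `J` on the first `i`
rows. In that case the swaps inside `J` can be taken along rows of `t` and are absorbed by `a`, and
each other swap contributes `-1`. Counting the pairs by `|J|` gives the sum in `ω_{ℓ,i}`. -/

noncomputable section

namespace SpechtPres

open Equiv

/-! ### Signed subgroup sums and the Hermitian form on the group algebra -/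

section GroupAlgebra

variable {G : Type*} [Group G] [Fintype G]

open Classical in
/-- The sum `∑ h ∈ H, χ(h) h` in the group algebra, for a sign character `χ`. -/
def twistedSum (H : Subgroup G) (χ : G →* ℤˣ) : MonoidAlgebra ℂ G :=
  ∑ h : H, ((χ (h : G) : ℤ) : ℂ) • MonoidAlgebra.of ℂ G h

theorem sign_mul_self (u : ℤˣ) : ((u : ℤ) : ℂ) * ((u : ℤ) : ℂ) = 1 := by
  rcases Int.units_eq_one_or u with rfl | rfl <;> simp

theorem of_mul_twistedSum (H : Subgroup G) (χ : G →* ℤˣ) {g : G} (hg : g ∈ H) :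
    MonoidAlgebra.of ℂ G g * twistedSum H χ = ((χ g : ℤ) : ℂ) • twistedSum H χ := by
  classical
  rw [twistedSum, Finset.mul_sum, Finset.smul_sum]
  refine Fintype.sum_equiv (Equiv.mulLeft (⟨g, hg⟩ : H)) _ _ fun h => ?_
  simp only [Equiv.coe_mulLeft, Subgroup.coe_mul, map_mul, Units.val_mul, Int.cast_mul,
    mul_smul_comm, smul_smul, ← mul_assoc, sign_mul_self, one_mul]

theorem twistedSum_mul_of (H : Subgroup G) (χ : G →* ℤˣ) {g : G} (hg : g ∈ H) :
    twistedSum H χ * MonoidAlgebra.of ℂ G g = ((χ g : ℤ) : ℂ) • twistedSum H χ := by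
  classical
  rw [twistedSum, Finset.sum_mul, Finset.smul_sum]
  refine Fintype.sum_equiv (Equiv.mulRight (⟨g, hg⟩ : H)) _ _ fun h => ?_
  simp only [Equiv.coe_mulRight, Subgroup.coe_mul, map_mul, Units.val_mul, Int.cast_mul,
    smul_mul_assoc, smul_smul, mul_left_comm _ ((χ (h : G) : ℤ) : ℂ), sign_mul_self, mul_one]

theorem twistedSum_mul_self (H : Subgroup G) (χ : G →* ℤˣ) :
    twistedSum H χ * twistedSum H χ = (Nat.card H : ℂ) • twistedSum H χ := by
  classical
  have h : ∀ h : H, (((χ (h : G) : ℤ) : ℂ) • MonoidAlgebra.of ℂ G h) * twistedSum H χ =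
      twistedSum H χ := fun h => by
    rw [smul_mul_assoc, of_mul_twistedSum H χ h.2, smul_smul, sign_mul_self, one_smul]
  conv_lhs => enter [1]; rw [twistedSum]
  rw [Finset.sum_mul, Finset.sum_congr rfl fun g _ => h g, Finset.sum_const, Finset.card_univ, Nat.card_eq_fintype_card, Nat.cast_smul_eq_nsmul]

theorem of_mul_twistedSum_comm (H : Subgroup G) (χ : G →* ℤˣ) {g : G}
    (hg : ∀ h ∈ H, g * h = h * g) :
    MonoidAlgebra.of ℂ G g * twistedSum H χ = twistedSum H χ * MonoidAlgebra.of ℂ G g := by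
  classical
  rw [twistedSum, Finset.mul_sum, Finset.sum_mul]
  refine Finset.sum_congr rfl fun h _ => ?_
  rw [mul_smul_comm, smul_mul_assoc, ← map_mul, ← map_mul, hg h h.2]

/-- The standard Hermitian form on the group algebra. -/
def hermitianForm (x y : MonoidAlgebra ℂ G) : ℂ := ∑ g, star (x.coeff g) * y.coeff g

open scoped ComplexOrder in
theorem hermitianForm_self_eq_zero {x : MonoidAlgebra ℂ G} (h : hermitianForm x x = 0) :
    x = 0 := by
  have h' : (star fun g => x.coeff g) ⬝ᵥ (fun g => x.coeff g) = 0 := h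
  rw [← MonoidAlgebra.coeff_eq_zero]
  ext g
  exact congrFun (dotProduct_star_self_eq_zero.1 h') g

theorem hermitianForm_zero_right (x : MonoidAlgebra ℂ G) : hermitianForm x 0 = 0 := by
  simp [hermitianForm]

theorem hermitianForm_smul_right (c : ℂ) (x y : MonoidAlgebra ℂ G) :
    hermitianForm x (c • y) = c * hermitianForm x y := by
  simp [hermitianForm, Finset.mul_sum, mul_left_comm]

theorem hermitianForm_smul_left (c : ℂ) (x y : MonoidAlgebra ℂ G) :
    hermitianForm (c • x) y = star c * hermitianForm x y := by
  simp [hermitianForm, Finset.mul_sum, mul_assoc]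

theorem hermitianForm_add_left (x x' y : MonoidAlgebra ℂ G) :
    hermitianForm (x + x') y = hermitianForm x y + hermitianForm x' y := by
  simp [hermitianForm, add_mul, Finset.sum_add_distrib]

omit [Group G] in
theorem hermitianForm_sum_left {ι : Type*} (s : Finset ι) (f : ι → MonoidAlgebra ℂ G)
    (y : MonoidAlgebra ℂ G) :
    hermitianForm (∑ j ∈ s, f j) y = ∑ j ∈ s, hermitianForm (f j) y := by
  simp only [hermitianForm, MonoidAlgebra.coeff_sum, Finset.sum_apply', star_sum, Finset.sum_mul]
  exact Finset.sum_comm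

omit [Group G] in
theorem hermitianForm_sum_right {ι : Type*} (s : Finset ι) (f : ι → MonoidAlgebra ℂ G)
    (x : MonoidAlgebra ℂ G) :
    hermitianForm x (∑ j ∈ s, f j) = ∑ j ∈ s, hermitianForm x (f j) := by
  simp only [hermitianForm, MonoidAlgebra.coeff_sum, Finset.sum_apply', Finset.mul_sum]
  exact Finset.sum_comm

theorem hermitianForm_of_mul (g : G) (x y : MonoidAlgebra ℂ G) :
    hermitianForm (MonoidAlgebra.of ℂ G g * x) y =
      hermitianForm x (MonoidAlgebra.of ℂ G g⁻¹ * y) := by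
  simp only [hermitianForm, MonoidAlgebra.of_apply, MonoidAlgebra.coeff_single_mul_apply, one_mul,
    inv_inv]
  refine Fintype.sum_equiv (Equiv.mulLeft g⁻¹) _ _ fun h => ?_
  simp

/-- The adjoint of left multiplication by `h` is multiplication by `h⁻¹`, and the real sign `χ`
takes the same value at both, so inversion of `H` shows that the sum is self-adjoint. -/
theorem hermitianForm_twistedSum_mul (H : Subgroup G) (χ : G →* ℤˣ) (x y : MonoidAlgebra ℂ G) :
    hermitianForm (twistedSum H χ * x) y = hermitianForm x (twistedSum H χ * y) := by
  classical
  simp only [twistedSum, Finset.sum_mul, hermitianForm_sum_left, hermitianForm_sum_right,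
    smul_mul_assoc, hermitianForm_smul_left, hermitianForm_smul_right, hermitianForm_of_mul]
  refine Fintype.sum_equiv (Equiv.inv H) _ _ fun h => ?_
  simp

theorem hermitianForm_eq_zero_of_annihilated {y u : MonoidAlgebra ℂ G} (x : MonoidAlgebra ℂ G)
    (h : ∀ g, hermitianForm y (MonoidAlgebra.of ℂ G g * u) = 0) :
    hermitianForm (x * y) u = 0 := by
  induction x using MonoidAlgebra.induction_on with
  | of g => rw [hermitianForm_of_mul]; exact h _
  | add p q hp hq => rw [add_mul, hermitianForm_add_left, hp, hq, add_zero]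
  | smul r p hp => rw [smul_mul_assoc, hermitianForm_smul_left, hp, mul_zero]

variable {H K : Subgroup G} {χ ψ : G →* ℤˣ}

/-- If `ab` kills `v` and `av`, then `ba` kills `v`. -/
theorem twistedSum_swap_mul_eq_zero {v : MonoidAlgebra ℂ G}
    (h : twistedSum H χ * (twistedSum K ψ * (twistedSum H χ * v)) = 0) :
    twistedSum K ψ * (twistedSum H χ * v) = 0 := by
  -- With `a`, `b` the sums over `H`, `K`: `⟨bav, bav⟩ = ⟨v, ab²av⟩ = |K| ⟨v, abav⟩ = 0`.
  apply hermitianForm_self_eq_zero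
  rw [hermitianForm_twistedSum_mul, hermitianForm_twistedSum_mul, ← mul_assoc (twistedSum K ψ),
    twistedSum_mul_self, smul_mul_assoc, mul_smul_comm, h, smul_zero, hermitianForm_zero_right]

theorem twistedSum_mul_twistedSum_sq_ne_zero (hne : twistedSum H χ * twistedSum K ψ ≠ 0) :
    twistedSum H χ * twistedSum K ψ * (twistedSum H χ * twistedSum K ψ) ≠ 0 := by
  intro h
  rw [mul_assoc] at h
  -- The previous lemma at `v = b` gives `bab = 0`; then `⟨ab, ab⟩ = |H| ⟨b, ab⟩ = |H| ⟨1, bab⟩ =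
  -- 0`.
  have h1 := twistedSum_swap_mul_eq_zero h
  apply hne
  apply hermitianForm_self_eq_zero
  rw [hermitianForm_twistedSum_mul, ← mul_assoc (twistedSum H χ), twistedSum_mul_self,
    smul_mul_assoc, hermitianForm_smul_right, ← mul_one (twistedSum K ψ),
    hermitianForm_twistedSum_mul, mul_one, h1, hermitianForm_zero_right, mul_zero]

/-- A left ideal inside `ℂG ab` which is killed by `ab` is zero. -/
theorem eq_zero_of_twistedSum_mul_eq_zero {u : MonoidAlgebra ℂ G}
    (hu : ∃ x, u = x * (twistedSum H χ * twistedSum K ψ))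
    (h : ∀ x, twistedSum H χ * twistedSum K ψ * (x * u) = 0) : u = 0 := by
  obtain ⟨x, hx⟩ := hu
  apply hermitianForm_self_eq_zero
  conv_lhs => rw [hx, ← hx]
  nth_rw 1 [hx]
  -- Since `u = x ab`, it suffices that `⟨ab, gu⟩ = ⟨1, bagu⟩` vanishes for each `g`; here `abagu =
  -- 0` by hypothesis, so `bagu = 0`.
  refine hermitianForm_eq_zero_of_annihilated x fun g => ?_
  rw [hermitianForm_twistedSum_mul]
  have h1 : twistedSum K ψ * (twistedSum H χ * (MonoidAlgebra.of ℂ G g * u)) = 0 := by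
    apply twistedSum_swap_mul_eq_zero
    simpa only [mul_assoc] using h (twistedSum H χ * MonoidAlgebra.of ℂ G g)
  rw [← mul_one (twistedSum K ψ), hermitianForm_twistedSum_mul, h1, hermitianForm_zero_right]

end GroupAlgebra

/-! ### Straightening tableaux relative to the two-cell rows of `t` -/

section NormalForm

theorem swap_apply_cases {X : Type*} [DecidableEq X] (x y z : X) :
    (z = x ∧ swap x y z = y) ∨ (z = y ∧ swap x y z = x) ∨ swap x y z = z := by
  rw [swap_apply_def]
  split_ifs <;> simp_all

variable {p q i q' N : ℕ}

theorem twoOne_mem_cells {p q : ℕ} (c : {c : ℕ × ℕ // c ∈ (twoOne p q).cells}) :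
    (c.1.2 = 0 ∧ c.1.1 < p + q) ∨ (c.1.2 = 1 ∧ c.1.1 < p) := by
  obtain ⟨r, rfl⟩ | ⟨r, rfl⟩ := cell_cases c
  · exact Or.inl ⟨rfl, r.2⟩
  · exact Or.inr ⟨rfl, r.2⟩

theorem twoOne_mk_mem_cells {r c : ℕ} (h : (c = 0 ∧ r < p + q) ∨ (c = 1 ∧ r < p)) :
    (r, c) ∈ (twoOne p q).cells := by
  simp only [twoOne, Finset.mem_union, Finset.mem_product, Finset.mem_range,
    Finset.mem_singleton]
  omega

theorem swap_mem_rowStabilizer {lam : YoungDiagram} (t : Tableau lam N) {x y : Fin N}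
    (h : (t.symm x).1.1 = (t.symm y).1.1) : swap x y ∈ t.rowStabilizer := by
  intro z
  rcases swap_apply_cases x y z with ⟨rfl, e⟩ | ⟨rfl, e⟩ | e
  · rw [e, h]
  · rw [e, h]
  · rw [e]

theorem swap_mem_colStabilizer {lam : YoungDiagram} (t : Tableau lam N) {x y : Fin N}
    (h : (t.symm x).1.2 = (t.symm y).1.2) : swap x y ∈ t.colStabilizer := by
  intro z
  rcases swap_apply_cases x y z with ⟨rfl, e⟩ | ⟨rfl, e⟩ | e
  · rw [e, h]
  · rw [e, h]
  · rw [e]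

/-- The tableau `s` has the letters of the two-cell rows of `t` in the same places as `t`. -/
def Agrees (t : Tableau (twoOne i q') N) (s : Tableau (twoOne p q) N) : Prop :=
  ∀ z, (t.symm z).1.1 < i → (s.symm z).1 = (t.symm z).1

/-- The permutation fixes the letters in the two-cell rows of `t`. -/
def FixesPairs (t : Tableau (twoOne i q') N) (β : Perm (Fin N)) : Prop :=
  ∀ z, (t.symm z).1.1 < i → β z = z

theorem exists_partner (t : Tableau (twoOne i q') N) {z : Fin N} (hz : (t.symm z).1.1 < i) :
    ∃ w, (t.symm w).1.1 = (t.symm z).1.1 ∧ (t.symm w).1.2 + (t.symm z).1.2 = 1 := by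
  refine ⟨t ⟨((t.symm z).1.1, 1 - (t.symm z).1.2), twoOne_mk_mem_cells ?_⟩, ?_, ?_⟩
  · rcases twoOne_mem_cells (t.symm z) with h | h <;> omega
  · simp
  · rcases twoOne_mem_cells (t.symm z) with h | h <;> simp [h.1]

theorem eq_of_row_eq_of_col_eq {lam : YoungDiagram} (t : Tableau lam N) {z w : Fin N}
    (h1 : (t.symm z).1.1 = (t.symm w).1.1) (h2 : (t.symm z).1.2 = (t.symm w).1.2) : z = w :=
  t.symm.injective (Subtype.ext (Prod.ext h1 h2))

theorem col_eq_zero_of_le (t : Tableau (twoOne i q') N) {z : Fin N} (hz : ¬ (t.symm z).1.1 < i) :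
    (t.symm z).1.2 = 0 := by
  rcases twoOne_mem_cells (t.symm z) with h | h <;> omega

theorem FixesPairs.row {t : Tableau (twoOne i q') N} {β : Perm (Fin N)} (h : FixesPairs t β)
    {z : Fin N} (hz : ¬ (t.symm z).1.1 < i) : ¬ (t.symm (β z)).1.1 < i := by
  intro hb
  have := β.injective (h _ hb)
  rw [this] at hb
  exact hz hb

theorem FixesPairs.mem_colStabilizer {t : Tableau (twoOne i q') N} {β : Perm (Fin N)}
    (h : FixesPairs t β) : β ∈ t.colStabilizer := by
  intro z
  by_cases hz : (t.symm z).1.1 < i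
  · rw [h z hz]
  · rw [col_eq_zero_of_le t hz, col_eq_zero_of_le t (h.row hz)]

theorem rowStabilizer_apply_of_le {t : Tableau (twoOne i q') N} {α : Perm (Fin N)}
    (hα : α ∈ t.rowStabilizer) {z : Fin N} (hz : ¬ (t.symm z).1.1 < i) : α z = z := by
  have h1 := hα z
  refine eq_of_row_eq_of_col_eq t h1 ?_
  rw [col_eq_zero_of_le t hz, col_eq_zero_of_le t (by rwa [h1])]

/-- The supports are disjoint: a row permutation of `t` moves only letters in two-cell rows, and `β`
moves only the others. -/
theorem FixesPairs.comm {t : Tableau (twoOne i q') N} {β : Perm (Fin N)}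
    (h : FixesPairs t β) {α : Perm (Fin N)} (hα : α ∈ t.rowStabilizer) : β * α = α * β := by
  ext1 z
  simp only [Perm.mul_apply]
  by_cases hz : (t.symm z).1.1 < i
  · rw [h z hz, h (α z) (by rwa [hα z])]
  · rw [rowStabilizer_apply_of_le hα hz, rowStabilizer_apply_of_le hα (h.row hz)]

/-- A row-invariant, column-antisymmetric function of tableaux vanishes at a tableau having two
letters of a row of `t` in the same column. -/
theorem eq_zero_of_same_col {lam lam' : YoungDiagram} {V : Type*} [AddCommGroup V] [Module ℂ V]
    (t : Tableau lam' N) (F : Tableau lam N → V)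
    (hcol : ∀ s (c d : {c : ℕ × ℕ // c ∈ lam.cells}), c ≠ d → c.1.2 = d.1.2 →
      F ((swap c d).trans s) = -F s)
    (hrow : ∀ s, ∀ σ ∈ t.rowStabilizer, F (s.trans σ) = F s)
    {s : Tableau lam N} {c d : {c : ℕ × ℕ // c ∈ lam.cells}} (hcd : c ≠ d) (h : c.1.2 = d.1.2)
    (hr : (t.symm (s c)).1.1 = (t.symm (s d)).1.1) : F s = 0 := by
  have h1 := hcol s c d hcd h
  have h2 := hrow s _ (swap_mem_rowStabilizer t hr)
  -- The same switch is both a column switch of cells and a row transposition of letters, so `F s =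
  -- -F s`.
  have h3 : s.trans (swap (s c) (s d)) = (swap c d).trans s := by
    ext x
    simp only [trans_apply, s.injective.swap_apply]
  rw [h3, h1] at h2
  have h4 : (2 : ℂ) • F s = 0 := by
    rw [two_smul]
    nth_rw 1 [← h2]
    exact neg_add_cancel _
  exact (smul_eq_zero.1 h4).resolve_left two_ne_zero

/-- Up to sign, a row-invariant, column-antisymmetric function of tableaux is determined by its
values at the images of `s₀` under permutations fixing the letters in the two-cell rows of `t`. -/
theorem exists_fixesPairs {V : Type*} [AddCommGroup V] [Module ℂ V]
    (t : Tableau (twoOne i q') N) {s₀ : Tableau (twoOne p q) N} (hs : Agrees t s₀)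
    (F : Tableau (twoOne p q) N → V)
    (hcol : ∀ s (c d : {c : ℕ × ℕ // c ∈ (twoOne p q).cells}), c ≠ d → c.1.2 = d.1.2 →
      F ((swap c d).trans s) = -F s)
    (hrow : ∀ s, ∀ σ ∈ t.rowStabilizer, F (s.trans σ) = F s) (s : Tableau (twoOne p q) N) :
    F s = 0 ∨ ∃ β, FixesPairs t β ∧ (F s = F (s₀.trans β) ∨ F s = -F (s₀.trans β)) := by
  classical
  -- Among the letters of the two-cell rows of `t`, `A` collects the misplaced ones and `B` those in
  -- the wrong column. The induction is on `|A| + |B|`.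
  let A := fun s : Tableau (twoOne p q) N =>
    Finset.univ.filter fun z => (t.symm z).1.1 < i ∧ s.symm z ≠ s₀.symm z
  let B := fun s : Tableau (twoOne p q) N =>
    Finset.univ.filter fun z => (t.symm z).1.1 < i ∧ (s.symm z).1.2 ≠ (s₀.symm z).1.2
  induction h : (A s).card + (B s).card using Nat.strong_induction_on generalizing s with
  | _ k ih =>
  subst h
  by_cases hA : ∃ z, (t.symm z).1.1 < i ∧ s.symm z ≠ s₀.symm z
  swap
  · push Not at hA
    refine Or.inr ⟨s₀.symm.trans s, fun z hz => ?_, Or.inl ?_⟩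
    · rw [trans_apply, ← hA z hz, apply_symm_apply]
    · congr 1
      ext
      simp
  obtain ⟨z, hz, hzs⟩ := hA
  by_cases hc : (s.symm z).1.2 = (s₀.symm z).1.2
  -- Right column, wrong row: a switch inside the column puts `z` in place at the cost of a sign, so
  -- `A` shrinks and `B` is unchanged.
  · have hsymm : ∀ w, ((swap (s.symm z) (s₀.symm z)).trans s).symm w =
        swap (s.symm z) (s₀.symm z) (s.symm w) := fun w => by simp
    have hcol' : ∀ c, (swap (s.symm z) (s₀.symm z) c).1.2 = c.1.2 := by
      intro c
      rcases swap_apply_cases (s.symm z) (s₀.symm z) c with ⟨rfl, e⟩ | ⟨rfl, e⟩ | e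
      · rw [e, hc]
      · rw [e, hc]
      · rw [e]
    have hB : B ((swap (s.symm z) (s₀.symm z)).trans s) = B s := by
      refine Finset.filter_congr fun w _ => ?_
      rw [hsymm, hcol']
    have hA : A ((swap (s.symm z) (s₀.symm z)).trans s) ⊂ A s := by
      refine Finset.ssubset_iff_of_subset ?_ |>.2 ⟨z, by simp [A, hz, hzs], fun h => ?_⟩
      swap
      · exact (Finset.mem_filter.1 h).2.2 ((hsymm z).trans (swap_apply_left _ _))
      intro w
      simp only [A, Finset.mem_filter, Finset.mem_univ, true_and, hsymm]
      rintro ⟨h1, h2⟩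
      refine ⟨h1, fun h3 => h2 ?_⟩
      rw [swap_apply_of_ne_of_ne, h3]
      · intro h4
        obtain rfl := s.symm.injective h4
        exact hzs h3
      · intro h4
        rw [h3] at h4
        obtain rfl := s₀.symm.injective h4
        exact hzs h3
    have key := ih _ (by rw [hB]; exact Nat.add_lt_add_right (Finset.card_lt_card hA) _)
      ((swap (s.symm z) (s₀.symm z)).trans s) rfl
    rw [hcol s _ _ hzs hc, neg_eq_zero] at key
    refine key.imp_right ?_
    rintro ⟨β, hβ, h | h⟩
    · exact ⟨β, hβ, Or.inr (by rw [← h, neg_neg])⟩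
    · exact ⟨β, hβ, Or.inl (neg_injective h)⟩
  -- Wrong column: either `z` and its row partner `w` share a column and `F s = 0`, or both are in
  -- the wrong column. Then the row transposition `swap z w` shrinks `B` and does not enlarge `A`.
  · obtain ⟨w, hw1, hw2⟩ := exists_partner t hz
    have hzw : z ≠ w := by
      rintro rfl
      omega
    have hw : (t.symm w).1.1 < i := by omega
    have e1 := congrArg Prod.snd (hs z hz)
    have e2 := congrArg Prod.snd (hs w hw)
    by_cases hsw : (s.symm z).1.2 = (s.symm w).1.2
    · left
      refine eq_zero_of_same_col t F hcol hrow (s.symm.injective.ne hzw) hsw ?_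
      simp [hw1]
    · have hsymm : ∀ x, (s.trans (swap z w)).symm x = s.symm (swap z w x) := fun x => by simp
      have b1 := twoOne_mem_cells (s.symm z)
      have b2 := twoOne_mem_cells (s.symm w)
      have hcw : (s.symm w).1.2 ≠ (s₀.symm w).1.2 := by omega
      have hws : s.symm w ≠ s₀.symm w := fun h => hcw (by rw [h])
      have hA : A (s.trans (swap z w)) ⊆ A s := by
        intro x
        simp only [A, Finset.mem_filter, Finset.mem_univ, true_and, hsymm]
        rintro ⟨h1, h2⟩
        refine ⟨h1, ?_⟩
        rcases swap_apply_cases z w x with ⟨rfl, e⟩ | ⟨rfl, e⟩ | e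
        · exact hzs
        · exact hws
        · rwa [e] at h2
      have hB : B (s.trans (swap z w)) ⊂ B s := by
        refine Finset.ssubset_iff_of_subset ?_ |>.2 ⟨z, by simp [B, hz, hc], ?_⟩
        · intro x
          simp only [B, Finset.mem_filter, Finset.mem_univ, true_and, hsymm]
          rintro ⟨h1, h2⟩
          refine ⟨h1, ?_⟩
          rcases swap_apply_cases z w x with ⟨rfl, e⟩ | ⟨rfl, e⟩ | e
          · exact hc
          · exact hcw
          · rwa [e] at h2
        · simp only [B, Finset.mem_filter, Finset.mem_univ, true_and, hsymm, swap_apply_left,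
            not_and, not_not]
          omega
      have key := ih _ (Nat.add_lt_add_of_le_of_lt (Finset.card_le_card hA)
        (Finset.card_lt_card hB)) (s.trans (swap z w)) rfl
      rwa [hrow s _ (swap_mem_rowStabilizer t hw1.symm)] at key

end NormalForm

/-! ### Young symmetrizers and their action on column tabloids -/

section Symmetrizer

variable {p q i q' N : ℕ}

/-- The row sum of a tableau. -/
def rowSum {lam : YoungDiagram} (t : Tableau lam N) : MonoidAlgebra ℂ (Perm (Fin N)) :=
  twistedSum t.rowStabilizer 1

/-- The signed column sum of a tableau. -/
def colSum {lam : YoungDiagram} (t : Tableau lam N) : MonoidAlgebra ℂ (Perm (Fin N)) :=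
  twistedSum t.colStabilizer Perm.sign

theorem symmetrizer_eq {lam : YoungDiagram} (t : Tableau lam N) :
    t.symmetrizer = rowSum t * colSum t := by
  simp [Tableau.symmetrizer, rowSum, colSum, twistedSum]

theorem rowSum_mul_of {lam : YoungDiagram} (t : Tableau lam N) {σ : Perm (Fin N)}
    (hσ : σ ∈ t.rowStabilizer) : rowSum t * MonoidAlgebra.of ℂ _ σ = rowSum t := by
  rw [rowSum, twistedSum_mul_of _ _ hσ]
  simp

theorem colSum_mul_of {lam : YoungDiagram} (t : Tableau lam N) {σ : Perm (Fin N)}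
    (hσ : σ ∈ t.colStabilizer) :
    colSum t * MonoidAlgebra.of ℂ _ σ = ((Perm.sign σ : ℤ) : ℂ) • colSum t :=
  twistedSum_mul_of _ _ hσ

theorem of_mul_colSum {lam : YoungDiagram} (t : Tableau lam N) {σ : Perm (Fin N)}
    (hσ : σ ∈ t.colStabilizer) :
    MonoidAlgebra.of ℂ _ σ * colSum t = ((Perm.sign σ : ℤ) : ℂ) • colSum t :=
  of_mul_twistedSum _ _ hσ

theorem FixesPairs.of_mul_rowSum {t : Tableau (twoOne i q') N} {β : Perm (Fin N)}
    (h : FixesPairs t β) :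
    MonoidAlgebra.of ℂ _ β * rowSum t = rowSum t * MonoidAlgebra.of ℂ _ β :=
  of_mul_twistedSum_comm _ _ fun _ hα => h.comm hα

/-- `β` commutes past the row sum and is then absorbed, with its sign, by the column sum. -/
theorem FixesPairs.colSum_mul_rowSum_mul_of {t : Tableau (twoOne i q') N} {β : Perm (Fin N)}
    (h : FixesPairs t β) : colSum t * rowSum t * MonoidAlgebra.of ℂ _ β =
      ((Perm.sign β : ℤ) : ℂ) • (colSum t * rowSum t) := by
  rw [mul_assoc, ← h.of_mul_rowSum, ← mul_assoc, colSum_mul_of t h.mem_colStabilizer,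
    smul_mul_assoc]

/-- `a x b` is a multiple of the Young symmetrizer `ab`. -/
theorem rowSum_mul_mul_colSum_mem (t : Tableau (twoOne i q') N)
    (x : MonoidAlgebra ℂ (Perm (Fin N))) :
    rowSum t * x * colSum t ∈ Submodule.span ℂ {rowSum t * colSum t} := by
  induction x using MonoidAlgebra.induction_on with
  | of g =>
    -- A tableau `s` is read as the permutation carrying `t` to `s`. A column switch of cells
    -- becomes right multiplication by an element of `C_t`, which `b` turns into a sign; `R_t` acts
    -- on the left and is absorbed by `a`.
    let F : Tableau (twoOne i q') N → MonoidAlgebra ℂ (Perm (Fin N)) := fun s =>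
      rowSum t * MonoidAlgebra.of ℂ _ (t.symm.trans s) * colSum t
    have hcol : ∀ s (c d : {c : ℕ × ℕ // c ∈ (twoOne i q').cells}), c ≠ d → c.1.2 = d.1.2 →
        F ((swap c d).trans s) = -F s := by
      intro s c d hcd h
      have e : t.symm.trans ((swap c d).trans s) = (t.symm.trans s) * swap (t c) (t d) := by
        ext x
        have := t.injective.swap_apply c d (t.symm x)
        simp only [apply_symm_apply] at this
        simp [Perm.mul_apply, this]
      have hm : swap (t c) (t d) ∈ t.colStabilizer := swap_mem_colStabilizer t (by simpa using h)
      simp only [F]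
      rw [e, map_mul, mul_assoc, mul_assoc, of_mul_colSum t hm,
        Perm.sign_swap (t.injective.ne hcd)]
      simp [mul_assoc]
    have hrow : ∀ s, ∀ σ ∈ t.rowStabilizer, F (s.trans σ) = F s := by
      intro s σ hσ
      have e : t.symm.trans (s.trans σ) = σ * t.symm.trans s := rfl
      simp only [F]
      rw [e, map_mul, ← mul_assoc, rowSum_mul_of t hσ]
    have key := exists_fixesPairs t (s₀ := t) (fun _ _ => rfl) F hcol hrow (t.trans g)
    have hF : ∀ g, F (t.trans g) = rowSum t * MonoidAlgebra.of ℂ _ g * colSum t := by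
      intro g
      have e : t.symm.trans (t.trans g) = g := by
        ext x
        simp
      simp only [F, e]
    simp only [hF] at key
    obtain h | ⟨β, hβ, h⟩ := key
    · rw [h]
      exact Submodule.zero_mem _
    · rw [mul_assoc _ (MonoidAlgebra.of ℂ _ β), of_mul_colSum t hβ.mem_colStabilizer,
        mul_smul_comm] at h
      have hm := Submodule.smul_mem _ ((Perm.sign β : ℤ) : ℂ)
        (Submodule.mem_span_singleton_self (R := ℂ) (rowSum t * colSum t))
      rcases h with h | h
      · rw [h]; exact hm
      · rw [h]; exact Submodule.neg_mem _ hm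
  | add x y hx hy => rw [mul_add, add_mul]; exact Submodule.add_mem _ hx hy
  | smul r x hx => rw [mul_smul_comm, smul_mul_assoc]; exact Submodule.smul_mem _ _ hx

theorem linearMap_tabloid_mem {lam : YoungDiagram} {V : Type*} [AddCommGroup V] [Module ℂ V]
    (f : ColumnTabloids lam N →ₗ[ℂ] V) (U : Submodule ℂ V)
    (h : ∀ s : Tableau lam N, f (tabloid s) ∈ U) (v : ColumnTabloids lam N) : f v ∈ U := by
  obtain ⟨x, rfl⟩ := (columnRelations lam N).mkQ_surjective v
  induction x using Finsupp.induction_linear with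
  | zero => simp
  | add x y hx hy => rw [map_add, map_add]; exact U.add_mem hx hy
  | single s r =>
    have e : Finsupp.single s r = r • Finsupp.single s (1 : ℂ) := by simp
    rw [e, map_smul, map_smul]
    exact U.smul_mem _ (h s)

/-- The action of the group algebra on column tabloids. -/
abbrev algebraAction (lam : YoungDiagram) (N : ℕ) :
    MonoidAlgebra ℂ (Perm (Fin N)) →ₐ[ℂ] Module.End ℂ (ColumnTabloids lam N) :=
  (columnTabloidRep lam N).asAlgebraHom

theorem algebraAction_of_tabloid {lam : YoungDiagram} (σ : Perm (Fin N)) (s : Tableau lam N) :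
    algebraAction lam N (MonoidAlgebra.of ℂ _ σ) (tabloid s) = tabloid (s.trans σ) := by
  rw [Representation.asAlgebraHom_of, columnTabloidRep_tabloid]

theorem algebraAction_mul_of_tabloid {lam : YoungDiagram} (x : MonoidAlgebra ℂ (Perm (Fin N)))
    (σ : Perm (Fin N)) (s : Tableau lam N) :
    algebraAction lam N (x * MonoidAlgebra.of ℂ _ σ) (tabloid s) =
      algebraAction lam N x (tabloid (s.trans σ)) := by
  rw [map_mul, Module.End.mul_apply, algebraAction_of_tabloid]

theorem algebraAction_colSum_mul_rowSum_row (t : Tableau (twoOne i q') N)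
    (s : Tableau (twoOne p q) N) {σ : Perm (Fin N)} (hσ : σ ∈ t.rowStabilizer) :
    algebraAction (twoOne p q) N (colSum t * rowSum t) (tabloid (s.trans σ)) =
      algebraAction (twoOne p q) N (colSum t * rowSum t) (tabloid s) := by
  rw [← algebraAction_mul_of_tabloid, mul_assoc, rowSum_mul_of t hσ]

/-- `ba` maps the column tabloids to the line spanned by `ba[s₀]`. -/
theorem algebraAction_colSum_mul_rowSum_mem (t : Tableau (twoOne i q') N)
    {s₀ : Tableau (twoOne p q) N} (hs : Agrees t s₀) (v : ColumnTabloids (twoOne p q) N) :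
    algebraAction (twoOne p q) N (colSum t * rowSum t) v ∈
      Submodule.span ℂ {algebraAction (twoOne p q) N (colSum t * rowSum t) (tabloid s₀)} := by
  refine linearMap_tabloid_mem _ _ (fun s => ?_) v
  have key := exists_fixesPairs t hs
    (fun s => algebraAction (twoOne p q) N (colSum t * rowSum t) (tabloid s))
    (fun s c d hcd h => by rw [tabloid_swap s hcd h, map_neg])
    (fun s σ hσ => algebraAction_colSum_mul_rowSum_row t s hσ) s
  obtain h | ⟨β, hβ, h⟩ := key
  · rw [h]
    exact Submodule.zero_mem _
  · simp only [← algebraAction_mul_of_tabloid, hβ.colSum_mul_rowSum_mul_of, map_smul,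
      LinearMap.smul_apply] at h
    have hm := Submodule.smul_mem _ ((Perm.sign β : ℤ) : ℂ) (Submodule.mem_span_singleton_self
      (R := ℂ) (algebraAction (twoOne p q) N (colSum t * rowSum t) (tabloid s₀)))
    rcases h with h | h
    · rw [h]; exact hm
    · rw [h]; exact Submodule.neg_mem _ hm

open Classical in
/-- The coefficient of `[s₀]`, as a function of tableaux. -/
def tableauCoeff {lam : YoungDiagram} (s₀ s : Tableau lam N) : ℂ :=
  if ∀ c, (s₀.symm (s c)).1.2 = c.1.2 then
    ((Perm.sign (s.trans s₀.symm : Perm {c : ℕ × ℕ // c ∈ lam.cells}) : ℤ) : ℂ) else 0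

theorem tableauCoeff_swap {lam : YoungDiagram} (s₀ s : Tableau lam N)
    {c d : {c : ℕ × ℕ // c ∈ lam.cells}} (hcd : c ≠ d) (h : c.1.2 = d.1.2) :
    tableauCoeff s₀ ((swap c d).trans s) = -tableauCoeff s₀ s := by
  have hcol : ∀ e, (swap c d e).1.2 = e.1.2 := by
    intro e
    rcases swap_apply_cases c d e with ⟨rfl, h'⟩ | ⟨rfl, h'⟩ | h'
    · rw [h', h]
    · rw [h', h]
    · rw [h']
  have hiff : (∀ e, (s₀.symm (((swap c d).trans s) e)).1.2 = e.1.2) ↔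
      ∀ e, (s₀.symm (s e)).1.2 = e.1.2 := by
    refine ⟨fun H e => ?_, fun H e => ?_⟩
    · have := H (swap c d e)
      rwa [trans_apply, swap_apply_self, hcol] at this
    · rw [trans_apply, H, hcol]
  have hsign : Perm.sign (((swap c d).trans s).trans s₀.symm) =
      -Perm.sign (s.trans s₀.symm : Perm {c : ℕ × ℕ // c ∈ lam.cells}) := by
    have e : ((swap c d).trans s).trans s₀.symm =
      (s.trans s₀.symm : Perm {c : ℕ × ℕ // c ∈ lam.cells}) * swap c d := rfl
    rw [e, Perm.sign_mul, Perm.sign_swap hcd, mul_neg, mul_one]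
  rw [tableauCoeff, tableauCoeff, hsign]
  simp only [hiff]
  split_ifs <;> simp

/-- The coefficient of `[s₀]`, as a linear form on column tabloids. -/
def tabloidCoeff {lam : YoungDiagram} (s₀ : Tableau lam N) : ColumnTabloids lam N →ₗ[ℂ] ℂ :=
  (columnRelations lam N).liftQ (Finsupp.linearCombination ℂ (tableauCoeff s₀)) (by
    refine Submodule.span_le.2 ?_
    rintro x ⟨t, c, d, hcd, hcol, rfl⟩
    simp [tableauCoeff_swap s₀ t hcd hcol])

theorem tabloidCoeff_tabloid {lam : YoungDiagram} (s₀ s : Tableau lam N) :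
    tabloidCoeff s₀ (tabloid s) = tableauCoeff s₀ s := by
  change Finsupp.linearCombination ℂ (tableauCoeff s₀) (Finsupp.single s 1) = _
  simp

open Classical in
theorem tableauCoeff_trans {lam : YoungDiagram} (s₀ : Tableau lam N) (σ : Perm (Fin N)) :
    tableauCoeff s₀ (s₀.trans σ) =
      if σ ∈ s₀.colStabilizer then ((Perm.sign σ : ℤ) : ℂ) else 0 := by
  have hsign : Perm.sign ((s₀.trans σ).trans s₀.symm) = Perm.sign σ := by
    simpa only [Equiv.trans_assoc] using! Perm.sign_symm_trans_trans σ s₀.symm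
  have hiff : (∀ c, (s₀.symm ((s₀.trans σ) c)).1.2 = c.1.2) ↔ σ ∈ s₀.colStabilizer := by
    refine ⟨fun H x => ?_, fun H c => ?_⟩
    · simpa using H (s₀.symm x)
    · simpa using H (s₀ c)
  rw [tableauCoeff, hsign]
  simp only [hiff]

/-- If `αβ` preserves the columns of `s₀`, where `α` and `β` are in the row and the column
stabilizer of `t`, then `α = 1`. -/
theorem eq_one_of_mul_mem_colStabilizer (t : Tableau (twoOne i q') N)
    {s₀ : Tableau (twoOne p q) N} (hs : Agrees t s₀) {α β : Perm (Fin N)}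
    (hα : α ∈ t.rowStabilizer) (hβ : β ∈ t.colStabilizer) (h : α * β ∈ s₀.colStabilizer) :
    α = 1 := by
  by_contra hne
  obtain ⟨z, hz⟩ : ∃ z, α z ≠ z := by
    by_contra! H
    exact hne (Equiv.ext H)
  -- If `α` moves `y` out of the second column of `t`, then `β⁻¹ y` lies in the second column of
  -- both `t` and `s₀`, while `αβ` sends it to the first. As `α` exchanges two letters of a row
  -- whenever it moves one, this excludes every moved letter.
  have key : ∀ y, α y ≠ y → (t.symm y).1.2 ≠ 1 := by
    intro y hy hy1
    have hrow : (t.symm y).1.1 < i := by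
      rcases twoOne_mem_cells (t.symm y) with h | h <;> omega
    have hay := hα y
    have hcol : (t.symm (α y)).1.2 ≠ (t.symm y).1.2 :=
      fun h => hy (eq_of_row_eq_of_col_eq t hay h)
    have hcol0 : (t.symm (α y)).1.2 = 0 := by
      rcases twoOne_mem_cells (t.symm (α y)) with h | h <;> omega
    obtain ⟨y, rfl⟩ := β.surjective y
    have hy' := hβ y
    have hrow' : (t.symm y).1.1 < i := by
      rcases twoOne_mem_cells (t.symm y) with h | h <;> omega
    have h1 := h y
    rw [Perm.mul_apply, hs _ hrow', hs _ (by omega), hcol0, ← hy', hy1] at h1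
    exact zero_ne_one h1
  have h1 := key z hz
  have h2 := key (α z) (fun h => hz (α.injective h))
  refine hz (eq_of_row_eq_of_col_eq t (hα z) ?_)
  rcases twoOne_mem_cells (t.symm z) with h3 | h3 <;>
    rcases twoOne_mem_cells (t.symm (α z)) with h4 | h4 <;> omega

/-- The coefficient of `[s₀]` counts the pairs `(α, β)` with `αβ` preserving the columns of `s₀`:
such a pair has `α = 1`, so its two signs cancel. The pair `(1, 1)` is counted. -/
theorem algebraAction_symmetrizer_ne_zero (t : Tableau (twoOne i q') N)
    {s₀ : Tableau (twoOne p q) N} (hs : Agrees t s₀) :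
    algebraAction (twoOne p q) N (rowSum t * colSum t) (tabloid s₀) ≠ 0 := by
  classical
  intro h
  have h1 := congrArg (tabloidCoeff s₀) h
  have hterm : ∀ (α : t.rowStabilizer) (β : t.colStabilizer),
      ((Perm.sign (β : Perm (Fin N)) : ℤ) : ℂ) *
        tableauCoeff s₀ (s₀.trans ((α : Perm (Fin N)) * (β : Perm (Fin N)))) =
      if (α : Perm (Fin N)) * (β : Perm (Fin N)) ∈ s₀.colStabilizer then 1 else 0 := by
    intro α β
    rw [tableauCoeff_trans]
    split_ifs with hm
    · rw [eq_one_of_mul_mem_colStabilizer t hs α.2 β.2 hm, one_mul, sign_mul_self]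
    · rw [mul_zero]
  rw [rowSum, colSum, twistedSum, twistedSum, Finset.sum_mul_sum, map_zero] at h1
  simp only [map_sum, LinearMap.sum_apply, mul_smul_comm, map_smul,
    LinearMap.smul_apply, ← map_mul, algebraAction_of_tabloid, tabloidCoeff_tabloid,
    smul_eq_mul, MonoidHom.one_apply, Units.val_one, Int.cast_one, one_smul] at h1
  simp only [hterm] at h1
  rw [← Fintype.sum_prod_type'
    (f := fun (α : t.rowStabilizer) (β : t.colStabilizer) =>
      if (α : Perm (Fin N)) * (β : Perm (Fin N)) ∈ s₀.colStabilizer then (1 : ℂ) else 0),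
    Finset.sum_boole, Nat.cast_eq_zero, Finset.card_eq_zero] at h1
  have : ((1, 1) : t.rowStabilizer × t.colStabilizer) ∈ (∅ : Finset _) := by
    rw [← h1]
    simp [one_mem]
  simp at this

end Symmetrizer

/-! ### Passing from group actions to group algebra actions -/

section Representation

variable {G V W : Type*} [Group G] [AddCommGroup V] [Module ℂ V] [AddCommGroup W] [Module ℂ W]

theorem intertwiningMap_asAlgebraHom {ρ : Representation ℂ G V} {σ : Representation ℂ G W}
    (f : Representation.IntertwiningMap ρ σ) (x : MonoidAlgebra ℂ G) (v : V) :
    f (ρ.asAlgebraHom x v) = σ.asAlgebraHom x (f v) := by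
  induction x using MonoidAlgebra.induction_on with
  | of g => rw [Representation.asAlgebraHom_of, Representation.asAlgebraHom_of, f.isIntertwining]
  | add x y hx hy =>
    rw [map_add, map_add, LinearMap.add_apply, LinearMap.add_apply, map_add, hx, hy]
  | smul r x hx =>
    rw [map_smul, map_smul, LinearMap.smul_apply, LinearMap.smul_apply, map_smul, hx]

theorem coe_toRepresentation_asAlgebraHom {ρ : Representation ℂ G V} (U : Subrepresentation ρ)
    (x : MonoidAlgebra ℂ G) (v : U.toSubmodule) :
    ((U.toRepresentation.asAlgebraHom x v : U.toSubmodule) : V) = ρ.asAlgebraHom x v :=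
  intertwiningMap_asAlgebraHom (ρ := U.toRepresentation) (σ := ρ)
    ⟨U.toSubmodule.subtype, fun _ => rfl⟩ x v

/-- The inclusion of a subrepresentation. -/
def subrepresentationInclusion {ρ : Representation ℂ G V} (U : Subrepresentation ρ) :
    Representation.IntertwiningMap U.toRepresentation ρ :=
  ⟨U.toSubmodule.subtype, fun _ => rfl⟩

theorem isIrreducible_of_equiv {ρ : Representation ℂ G V} {σ : Representation ℂ G W}
    (e : Representation.Equiv ρ σ) [σ.IsIrreducible] : ρ.IsIrreducible := by
  rw [Representation.irreducible_iff_isSimpleModule_asModule]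
  let f := Representation.IntertwiningMap.equivLinearMapAsModule ρ σ e.toIntertwiningMap
  have hf : Function.Bijective f := EquivLike.bijective e
  exact IsSimpleModule.congr (LinearEquiv.ofBijective f hf)

theorem regularRep_asAlgebraHom {N : ℕ} (x y : MonoidAlgebra ℂ (Perm (Fin N))) :
    (regularRep N).asAlgebraHom x y = x * y := by
  induction x using MonoidAlgebra.induction_on with
  | of g => rw [Representation.asAlgebraHom_of]; rfl
  | add x x' hx hx' => rw [map_add, LinearMap.add_apply, hx, hx', add_mul]
  | smul r x hx => rw [map_smul, LinearMap.smul_apply, hx, smul_mul_assoc]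

end Representation

/-! ### Irreducibility of Specht modules and multiplicity at most one -/

section Specht

variable {p q i q' N : ℕ}

theorem mul_symmetrizer_mem_specht {lam : YoungDiagram} (t : Tableau lam N)
    (x : MonoidAlgebra ℂ (Perm (Fin N))) :
    x * t.symmetrizer ∈ (specht t).toSubmodule := by
  induction x using MonoidAlgebra.induction_on with
  | of g => exact Submodule.subset_span ⟨g, rfl⟩
  | add x y hx hy => rw [add_mul]; exact Submodule.add_mem _ hx hy
  | smul r x hx => rw [smul_mul_assoc]; exact Submodule.smul_mem _ _ hx

theorem exists_eq_mul_symmetrizer {lam : YoungDiagram} (t : Tableau lam N)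
    {v : MonoidAlgebra ℂ (Perm (Fin N))} (hv : v ∈ (specht t).toSubmodule) :
    ∃ x, v = x * t.symmetrizer := by
  induction hv using Submodule.span_induction with
  | mem x hx => obtain ⟨τ, rfl⟩ := hx; exact ⟨_, rfl⟩
  | zero => exact ⟨0, by simp⟩
  | add x y _ _ hx hy =>
    obtain ⟨x, rfl⟩ := hx
    obtain ⟨y, rfl⟩ := hy
    exact ⟨x + y, by rw [add_mul]⟩
  | smul a x _ hx =>
    obtain ⟨x, rfl⟩ := hx
    exact ⟨a • x, by rw [smul_mul_assoc]⟩

/-- The Young symmetrizer as an element of the Specht module. -/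
def spechtGenerator {lam : YoungDiagram} (t : Tableau lam N) : (specht t).toSubmodule :=
  ⟨t.symmetrizer, by simpa using mul_symmetrizer_mem_specht t 1⟩

theorem exists_eq_asAlgebraHom_spechtGenerator {lam : YoungDiagram} (t : Tableau lam N)
    (v : (specht t).toSubmodule) :
    ∃ x, v = (specht t).toRepresentation.asAlgebraHom x (spechtGenerator t) := by
  obtain ⟨x, hx⟩ := exists_eq_mul_symmetrizer t v.2
  refine ⟨x, Subtype.ext ?_⟩
  rw [hx, coe_toRepresentation_asAlgebraHom, regularRep_asAlgebraHom]
  rfl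

theorem symmetrizer_ne_zero (t : Tableau (twoOne i q') N) : t.symmetrizer ≠ 0 := by
  intro h
  apply algebraAction_symmetrizer_ne_zero t (s₀ := t) (fun _ _ => rfl)
  rw [← symmetrizer_eq, h, map_zero, LinearMap.zero_apply]

theorem spechtGenerator_ne_zero (t : Tableau (twoOne i q') N) : spechtGenerator t ≠ 0 :=
  fun h => symmetrizer_ne_zero t (congrArg Subtype.val h)

/-- Regroup `ab x ab` as `a (b x a) b`. -/
theorem exists_symmetrizer_mul_eq (t : Tableau (twoOne i q') N)
    (x : MonoidAlgebra ℂ (Perm (Fin N))) :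
    ∃ c : ℂ, t.symmetrizer * (x * t.symmetrizer) = c • t.symmetrizer := by
  obtain ⟨c, hc⟩ := Submodule.mem_span_singleton.1
    (rowSum_mul_mul_colSum_mem t (colSum t * x * rowSum t))
  refine ⟨c, ?_⟩
  rw [symmetrizer_eq, hc]
  simp only [mul_assoc]

theorem exists_symmetrizer_sq_eq (t : Tableau (twoOne i q') N) :
    ∃ c : ℂ, c ≠ 0 ∧ t.symmetrizer * t.symmetrizer = c • t.symmetrizer := by
  obtain ⟨c, hc⟩ := exists_symmetrizer_mul_eq t 1
  rw [one_mul] at hc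
  refine ⟨c, ?_, hc⟩
  rintro rfl
  rw [zero_smul] at hc
  have hne := symmetrizer_ne_zero t
  rw [symmetrizer_eq] at hc hne
  exact twistedSum_mul_twistedSum_sq_ne_zero hne hc

theorem specht_isIrreducible (t : Tableau (twoOne i q') N) :
    (specht t).toRepresentation.IsIrreducible := by
  have hbot : (⊥ : Subrepresentation (specht t).toRepresentation).toSubmodule = ⊥ := rfl
  have htop : (⊤ : Subrepresentation (specht t).toRepresentation).toSubmodule = ⊤ := rfl
  have hnt : Nontrivial (Subrepresentation (specht t).toRepresentation) := by
    refine ⟨⊥, ⊤, fun h => spechtGenerator_ne_zero t ?_⟩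
    have h' := congrArg Subrepresentation.toSubmodule h
    rw [hbot, htop] at h'
    exact (Submodule.mem_bot ℂ).1 (h' ▸ Submodule.mem_top)
  refine { eq_bot_or_eq_top := fun U => ?_ }
  have hU : ∀ x, ∀ u ∈ U.toSubmodule,
      (specht t).toRepresentation.asAlgebraHom x u ∈ U.toSubmodule := by
    intro x u hu
    have := coe_toRepresentation_asAlgebraHom U x ⟨u, hu⟩
    rw [← this]
    exact Subtype.property _
  -- If `e_t` kills `U`, positivity of the form gives `U = 0`. Otherwise some `e_t u` is a nonzero
  -- multiple of `e_t`, and the generator lies in `U`.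
  by_cases h : ∀ u ∈ U.toSubmodule, t.symmetrizer * (u : MonoidAlgebra ℂ (Perm (Fin N))) = 0
  · left
    apply Subrepresentation.toSubmodule_injective
    rw [hbot, Submodule.eq_bot_iff]
    intro u hu
    apply Subtype.ext
    refine eq_zero_of_twistedSum_mul_eq_zero (H := t.rowStabilizer) (K := t.colStabilizer)
      (χ := 1) (ψ := Perm.sign) ?_ fun x => ?_
    · obtain ⟨x, hx⟩ := exists_eq_mul_symmetrizer t u.2
      exact ⟨x, hx.trans (by rw [symmetrizer_eq]; rfl)⟩
    · have := h _ (hU x u hu)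
      rw [coe_toRepresentation_asAlgebraHom, regularRep_asAlgebraHom, symmetrizer_eq] at this
      exact this
  · right
    push Not at h
    obtain ⟨u, hu, hne⟩ := h
    apply Subrepresentation.toSubmodule_injective
    rw [htop, Submodule.eq_top_iff']
    intro v
    obtain ⟨x, hx⟩ := exists_eq_mul_symmetrizer t u.2
    obtain ⟨c, hc⟩ := exists_symmetrizer_mul_eq t x
    rw [← hx] at hc
    have hc0 : c ≠ 0 := by
      rintro rfl
      rw [zero_smul] at hc
      exact hne hc
    have hgen : spechtGenerator t =
        c⁻¹ • (specht t).toRepresentation.asAlgebraHom t.symmetrizer u := by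
      apply Subtype.ext
      rw [Submodule.coe_smul, coe_toRepresentation_asAlgebraHom, regularRep_asAlgebraHom, hc,
        inv_smul_smul₀ hc0]
      rfl
    obtain ⟨y, rfl⟩ := exists_eq_asAlgebraHom_spechtGenerator t v
    apply hU
    rw [hgen]
    exact U.toSubmodule.smul_mem _ (hU _ _ hu)

/-- An intertwining map from the Specht module to the column tabloids sends the generator into the
line spanned by `aba[s₀]`. -/
theorem intertwiningMap_spechtGenerator (t : Tableau (twoOne i q') N)
    {s₀ : Tableau (twoOne p q) N} (hs : Agrees t s₀)
    (f : Representation.IntertwiningMap (specht t).toRepresentation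
      (columnTabloidRep (twoOne p q) N)) :
    ∃ c : ℂ, f (spechtGenerator t) = c • algebraAction (twoOne p q) N (rowSum t)
      (algebraAction (twoOne p q) N (colSum t * rowSum t) (tabloid s₀)) := by
  obtain ⟨c, hc0, hc⟩ := exists_symmetrizer_sq_eq t
  have h1 : spechtGenerator t = c⁻¹ • (specht t).toRepresentation.asAlgebraHom t.symmetrizer
      (spechtGenerator t) := by
    apply Subtype.ext
    rw [Submodule.coe_smul, coe_toRepresentation_asAlgebraHom, regularRep_asAlgebraHom]
    change t.symmetrizer = c⁻¹ • (t.symmetrizer * t.symmetrizer)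
    rw [hc, inv_smul_smul₀ hc0]
  have h2 : f (spechtGenerator t) =
      c⁻¹ • algebraAction (twoOne p q) N t.symmetrizer (f (spechtGenerator t)) := by
    conv_lhs => rw [h1]
    rw [map_smul, intertwiningMap_asAlgebraHom]
  -- Two factors `e_t` are needed to make the product `ba`, whose image in the tabloids is at most a
  -- line, appear in the middle.
  have h3 : t.symmetrizer * t.symmetrizer = rowSum t * ((colSum t * rowSum t) * colSum t) := by
    rw [symmetrizer_eq]
    simp only [mul_assoc]
  obtain ⟨d, hd⟩ := Submodule.mem_span_singleton.1 (algebraAction_colSum_mul_rowSum_mem t hs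
    (algebraAction (twoOne p q) N (colSum t) (f (spechtGenerator t))))
  refine ⟨c⁻¹ * c⁻¹ * d, ?_⟩
  rw [h2, h2, map_smul, ← Module.End.mul_apply, ← map_mul, h3, map_mul, map_mul,
    Module.End.mul_apply, Module.End.mul_apply, ← hd, map_smul, smul_smul, smul_smul]

end Specht

/-! ### `η_ℓ` commutes with the symmetric group -/

section EtaEquivariance

variable {p q N : ℕ}

theorem eta_columnTabloidRep (ℓ : ℕ) (σ : Perm (Fin N)) (v : ColumnTabloids (twoOne p q) N) :
    eta p q N ℓ (columnTabloidRep (twoOne p q) N σ v) =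
      columnTabloidRep (twoOne p q) N σ (eta p q N ℓ v) := by
  rw [← sub_eq_zero, ← Submodule.mem_bot ℂ]
  refine linearMap_tabloid_mem (eta p q N ℓ ∘ₗ columnTabloidRep (twoOne p q) N σ -
    columnTabloidRep (twoOne p q) N σ ∘ₗ eta p q N ℓ) ⊥ (fun s => ?_) v
  simp only [LinearMap.sub_apply, LinearMap.comp_apply, Submodule.mem_bot, sub_eq_zero,
    columnTabloidRep_tabloid, eta_tabloid, etaTableau, map_sub, map_smul, map_sum]
  rfl

theorem eta_algebraAction (ℓ : ℕ) (x : MonoidAlgebra ℂ (Perm (Fin N)))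
    (v : ColumnTabloids (twoOne p q) N) :
    eta p q N ℓ (algebraAction (twoOne p q) N x v) =
      algebraAction (twoOne p q) N x (eta p q N ℓ v) :=
  intertwiningMap_asAlgebraHom (ρ := columnTabloidRep (twoOne p q) N)
    (σ := columnTabloidRep (twoOne p q) N)
    ⟨eta p q N ℓ, fun σ => LinearMap.ext fun v => eta_columnTabloidRep ℓ σ v⟩ x v

end EtaEquivariance

/-! ### The effect of `ba` on exchanged tableaux -/

section Exchanged

variable {p q i q' N : ℕ}

theorem apply_exchange {X Y : Type*} [DecidableEq X] [DecidableEq Y] (s : X ≃ Y) {ℓ : ℕ}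
    (a b : Fin ℓ → X) (x : X) :
    s (exchange a b x) = exchange (s ∘ a) (s ∘ b) (s x) := by
  induction ℓ with
  | zero => simp [exchange]
  | succ ℓ ih =>
    rw [exchange_succ, exchange_succ, Perm.mul_apply, Perm.mul_apply, ← s.injective.swap_apply, ih]
    rfl

/-- Each transposition is absorbed in turn: within a two-cell row of `t` by the row sum, with factor
`1`; between letters outside these rows by the column sum, with factor `-1`. -/
theorem colSum_mul_rowSum_mul_exchange (t : Tableau (twoOne i q') N) {ℓ : ℕ} (u v : Fin ℓ → Fin N)
    (h : ∀ k, ((t.symm (u k)).1.1 < i ∧ (t.symm (u k)).1.1 = (t.symm (v k)).1.1) ∨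
      (¬ (t.symm (u k)).1.1 < i ∧ ¬ (t.symm (v k)).1.1 < i ∧ u k ≠ v k)) :
    colSum t * rowSum t * MonoidAlgebra.of ℂ _ (exchange u v) =
      (∏ k, if (t.symm (u k)).1.1 < i then (1 : ℂ) else -1) • (colSum t * rowSum t) := by
  induction ℓ with
  | zero =>
    have : exchange u v = 1 := by simp [exchange]
    simp only [this, map_one, mul_one, Finset.univ_eq_empty, Finset.prod_empty, one_smul]
  | succ ℓ ih =>
    have h0 : colSum t * rowSum t * MonoidAlgebra.of ℂ _ (swap (u 0) (v 0)) =
        (if (t.symm (u 0)).1.1 < i then (1 : ℂ) else -1) • (colSum t * rowSum t) := by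
      rcases h 0 with ⟨h1, h2⟩ | ⟨h1, h2, h3⟩
      · rw [if_pos h1, one_smul, mul_assoc, rowSum_mul_of t (swap_mem_rowStabilizer t h2)]
      · have hf : FixesPairs t (swap (u 0) (v 0)) := fun z hz =>
          swap_apply_of_ne_of_ne (fun e => h1 (e ▸ hz)) (fun e => h2 (e ▸ hz))
        rw [if_neg h1, hf.colSum_mul_rowSum_mul_of, Perm.sign_swap h3]
        simp
    rw [exchange_succ, map_mul, ← mul_assoc, h0, smul_mul_assoc,
      ih (fun k => u k.succ) (fun k => v k.succ) (fun k => h k.succ), smul_smul,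
      Fin.prod_univ_succ]

/-- If two index maps take the same values below `i`, the second one can be rearranged so as to
agree with the first one at these values. -/
theorem exists_rearrangement {ℓ n m : ℕ} {a : Fin ℓ → Fin n} {b : Fin ℓ → Fin m}
    (ha : Function.Injective a) (hb : Function.Injective b)
    (h : ∀ j < i, (∃ k, (a k : ℕ) = j) ↔ ∃ k, (b k : ℕ) = j) :
    ∃ b' : Fin ℓ → Fin m, Function.Injective b' ∧ Set.range b' = Set.range b ∧
      ∀ k, ((a k : ℕ) < i ∧ (b' k : ℕ) = a k) ∨ (¬ (a k : ℕ) < i ∧ ¬ (b' k : ℕ) < i) := by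
  classical
  -- Matching equal values below `i` gives a bijection between two subsets of `Fin ℓ`; any extension
  -- to a permutation reorders `b` as required.
  choose f hf using fun k : {k // (a k : ℕ) < i} => (h _ k.2).1 ⟨k, rfl⟩
  have hbij : Function.Bijective
      (fun k : {k // (a k : ℕ) < i} => (⟨f k, by rw [hf]; exact k.2⟩ : {k // (b k : ℕ) < i})) := by
    constructor
    · intro k k' hk
      have e : f k = f k' := congrArg Subtype.val hk
      have e' := congrArg (fun x => (b x : ℕ)) e
      simp only [hf] at e'
      exact Subtype.ext (ha (Fin.ext e'))
    · rintro ⟨k, hk⟩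
      obtain ⟨k', hk'⟩ := (h _ hk).2 ⟨k, rfl⟩
      refine ⟨⟨k', by rw [hk']; exact hk⟩, Subtype.ext (hb (Fin.ext ?_))⟩
      simp only [hf, hk']
  let e := Equiv.ofBijective _ hbij
  refine ⟨b ∘ e.extendSubtype, hb.comp e.extendSubtype.injective,
    e.extendSubtype.surjective.range_comp b, fun k => ?_⟩
  by_cases hk : (a k : ℕ) < i
  · refine Or.inl ⟨hk, ?_⟩
    rw [Function.comp_apply, e.extendSubtype_apply_of_mem k hk]
    exact hf ⟨k, hk⟩
  · exact Or.inr ⟨hk, e.extendSubtype_not_mem k hk⟩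

theorem Agrees.row_lt_iff {t : Tableau (twoOne i q') N} {s₀ : Tableau (twoOne p q) N}
    (hs : Agrees t s₀) (c : {c : ℕ × ℕ // c ∈ (twoOne p q).cells}) :
    (t.symm (s₀ c)).1.1 < i ↔ c.1.1 < i := by
  constructor
  · intro h
    have := hs _ h
    rw [symm_apply_apply] at this
    rwa [this]
  · intro h
    have hc : c.1 ∈ (twoOne i q').cells := twoOne_mk_mem_cells (r := c.1.1) (c := c.1.2) (by
      rcases twoOne_mem_cells c with h' | h' <;> omega)
    have e := hs (t ⟨c.1, hc⟩) (by simpa using h)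
    rw [symm_apply_apply] at e
    have e' : s₀.symm (t ⟨c.1, hc⟩) = c := Subtype.ext e
    rw [← e', apply_symm_apply, symm_apply_apply]
    simpa using h

theorem Agrees.row_eq {t : Tableau (twoOne i q') N} {s₀ : Tableau (twoOne p q) N}
    (hs : Agrees t s₀) {c : {c : ℕ × ℕ // c ∈ (twoOne p q).cells}}
    (hc : c.1.1 < i) : (t.symm (s₀ c)).1.1 = c.1.1 := by
  rw [← hs _ ((hs.row_lt_iff c).2 hc), symm_apply_apply]

/-- The set of values of a map into `Fin n`, as a set of natural numbers. -/
def valueSet {ℓ n : ℕ} (a : Fin ℓ → Fin n) : Finset ℕ := Finset.univ.image fun k => (a k : ℕ)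

theorem mem_valueSet {ℓ n : ℕ} {a : Fin ℓ → Fin n} {j : ℕ} :
    j ∈ valueSet a ↔ ∃ k, (a k : ℕ) = j := by
  simp [valueSet]

theorem prod_sign_eq {ℓ n : ℕ} {a : Fin ℓ → Fin n} (ha : Function.Injective a) (i : ℕ) :
    (∏ k, if (a k : ℕ) < i then (1 : ℂ) else -1) =
      (-1) ^ (ℓ - (valueSet a ∩ Finset.range i).card) := by
  have h1 : (valueSet a ∩ Finset.range i).card =
      (Finset.univ.filter fun k => (a k : ℕ) < i).card := by
    rw [← Finset.card_image_of_injective _ (Fin.val_injective.comp ha)]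
    congr 1
    ext j
    simp only [Finset.mem_inter, mem_valueSet, Finset.mem_range, Finset.mem_image,
      Finset.mem_filter, Finset.mem_univ, true_and, Function.comp_apply]
    constructor
    · rintro ⟨⟨k, rfl⟩, h⟩; exact ⟨k, h, rfl⟩
    · rintro ⟨k, h, rfl⟩; exact ⟨⟨k, rfl⟩, h⟩
  have h2 := Finset.card_filter_add_card_filter_not (s := (Finset.univ : Finset (Fin ℓ)))
    (fun k => (a k : ℕ) < i)
  rw [Finset.card_univ, Fintype.card_fin] at h2
  rw [Finset.prod_ite, Finset.prod_const_one, one_mul, Finset.prod_const, h1]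
  congr 1
  omega

/-- The effect of `ba` on an exchange applied to `s₀`. -/
theorem algebraAction_swapEntries (t : Tableau (twoOne i q') N)
    {s₀ : Tableau (twoOne p q) N} (hs : Agrees t s₀) (hip : i ≤ p) {ℓ : ℕ}
    {a : Fin ℓ → Fin (p + q)} {b : Fin ℓ → Fin p} (ha : Function.Injective a)
    (hb : Function.Injective b) :
    algebraAction (twoOne p q) N (colSum t * rowSum t) (tabloid (swapEntries s₀ a b)) =
      (if valueSet a ∩ Finset.range i = valueSet b ∩ Finset.range i then
        (-1 : ℂ) ^ (ℓ - (valueSet a ∩ Finset.range i).card) else 0) •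
      algebraAction (twoOne p q) N (colSum t * rowSum t) (tabloid s₀) := by
  split_ifs with h
  · have h' : ∀ j < i, (∃ k, (a k : ℕ) = j) ↔ ∃ k, (b k : ℕ) = j := by
      intro j hj
      have := congrArg (fun S => j ∈ S) h
      simpa [mem_valueSet, hj] using this
    -- The order-preserving pairing need not match equal rows. The tabloid depends only on the two
    -- row sets, so the pairing may be changed to one that swaps along rows wherever the row is
    -- below `i`.
    obtain ⟨b', hb', hr, hk⟩ := exists_rearrangement ha hb h'
    rw [tabloid_swapEntries_congr s₀ ha ha hb hb' rfl hr.symm]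
    have e : swapEntries s₀ a b' = s₀.trans (exchange (fun k => s₀ (leftCell (a k)))
        (fun k => s₀ (rightCell (b' k)))) :=
      Equiv.ext fun c => apply_exchange s₀ _ _ c
    rw [e, ← algebraAction_mul_of_tabloid, colSum_mul_rowSum_mul_exchange]
    · rw [map_smul, LinearMap.smul_apply, ← prod_sign_eq ha]
      simp only [hs.row_lt_iff]
      rfl
    · intro k
      rw [hs.row_lt_iff, hs.row_lt_iff]
      refine (hk k).imp ?_ ?_
      · rintro ⟨h1, h2⟩
        refine ⟨h1, ?_⟩
        rw [hs.row_eq h1,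
          hs.row_eq (c := rightCell (b' k)) (by change (b' k : ℕ) < i; omega)]
        exact h2.symm
      · rintro ⟨h1, h2⟩
        exact ⟨h1, h2, s₀.injective.ne (leftCell_ne_rightCell _ _)⟩
  · rw [zero_smul]
    have hcol : ∀ s (c d : {c : ℕ × ℕ // c ∈ (twoOne p q).cells}), c ≠ d → c.1.2 = d.1.2 →
        algebraAction (twoOne p q) N (colSum t * rowSum t) (tabloid ((swap c d).trans s)) =
          -algebraAction (twoOne p q) N (colSum t * rowSum t) (tabloid s) :=
      fun s c d hcd h => by rw [tabloid_swap s hcd h, map_neg]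
    have hleft : ∀ k, swapEntries s₀ a b (leftCell (a k)) = s₀ (rightCell (b k)) := fun k =>
      congrArg s₀ (exchange_left (leftCell_injective.comp ha) (rightCell_injective.comp hb)
        (fun _ _ => leftCell_ne_rightCell _ _) k)
    have hright : ∀ k, swapEntries s₀ a b (rightCell (b k)) = s₀ (leftCell (a k)) := fun k =>
      congrArg s₀ (exchange_right (leftCell_injective.comp ha) (rightCell_injective.comp hb)
        (fun _ _ => leftCell_ne_rightCell _ _) k)
    -- For a row `j < i` chosen in only one column, one of its two letters crosses over and joins
    -- its partner, which stays. Two letters of a row of `t` then share a column, and `ba` gives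
    -- zero.
    obtain ⟨j, hj, hne⟩ : ∃ j < i, ¬ ((∃ k, (a k : ℕ) = j) ↔ ∃ k, (b k : ℕ) = j) := by
      by_contra! H
      refine h (Finset.ext fun j => ?_)
      simp only [Finset.mem_inter, mem_valueSet, Finset.mem_range, and_congr_left_iff]
      exact H j
    by_cases hja : ∃ k, (a k : ℕ) = j
    · obtain ⟨k, hk⟩ := hja
      have hjb : ∀ k', (b k' : ℕ) ≠ j := fun k' hk' =>
        hne ⟨fun _ => ⟨k', hk'⟩, fun _ => ⟨k, hk⟩⟩
      have hfix : swapEntries s₀ a b (rightCell ⟨j, by omega⟩) = s₀ (rightCell ⟨j, by omega⟩) :=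
        congrArg s₀ (exchange_of_ne (fun _ => (leftCell_ne_rightCell _ _).symm)
          (fun k' e => hjb k' (congrArg Fin.val (rightCell_injective e)).symm))
      refine eq_zero_of_same_col t
        (fun s => algebraAction (twoOne p q) N (colSum t * rowSum t) (tabloid s)) hcol
        (fun s σ hσ => algebraAction_colSum_mul_rowSum_row t s hσ)
        (c := rightCell (b k)) (d := rightCell ⟨j, by omega⟩) ?_ rfl ?_
      · exact rightCell_injective.ne fun e => hjb k (congrArg Fin.val e)
      · rw [hright, hfix, hs.row_eq (c := leftCell (a k)) (by change (a k : ℕ) < i; omega),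
          hs.row_eq (by exact hj)]
        exact hk
    · obtain ⟨k, hk⟩ : ∃ k, (b k : ℕ) = j := by
        by_contra hjb
        exact hne ⟨fun h => absurd h hja, fun h => absurd h hjb⟩
      push Not at hja
      have hfix : swapEntries s₀ a b (leftCell ⟨j, by omega⟩) = s₀ (leftCell ⟨j, by omega⟩) :=
        congrArg s₀ (exchange_of_ne
          (fun k' e => hja k' (congrArg Fin.val (leftCell_injective e)).symm)
          (fun _ => leftCell_ne_rightCell _ _))
      refine eq_zero_of_same_col t
        (fun s => algebraAction (twoOne p q) N (colSum t * rowSum t) (tabloid s)) hcol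
        (fun s σ hσ => algebraAction_colSum_mul_rowSum_row t s hσ)
        (c := leftCell (a k)) (d := leftCell ⟨j, by omega⟩) ?_ rfl ?_
      · exact leftCell_injective.ne fun e => hja k (congrArg Fin.val e)
      · rw [hleft, hfix, hs.row_eq (c := rightCell (b k)) (by change (b k : ℕ) < i; omega),
          hs.row_eq (by exact hj)]
        exact hk

end Exchanged

/-! ### Counting pairs of row sets by their common trace -/

section Counting

theorem sum_orderEmbedding_valueSet {ℓ n : ℕ} {A : Type*} [AddCommMonoid A] (f : Finset ℕ → A) :
    ∑ a : Fin ℓ ↪o Fin n, f (valueSet a) =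
      ∑ S ∈ Finset.powersetCard ℓ (Finset.range n), f S := by
  refine Finset.sum_bij (fun a _ => valueSet a) ?_ ?_ ?_ fun _ _ => rfl
  · intro a _
    have hcard : (valueSet a).card = Fintype.card (Fin ℓ) :=
      Finset.card_image_of_injective _ (Fin.val_injective.comp a.injective)
    rw [Finset.mem_powersetCard, hcard, Fintype.card_fin]
    refine ⟨fun j hj => ?_, rfl⟩
    obtain ⟨k, rfl⟩ := mem_valueSet.1 hj
    exact Finset.mem_range.2 (a k).2
  · intro a _ a' _ h
    refine OrderEmbedding.range_inj.1 (Set.ext fun x => ?_)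
    have := congrArg (fun S => (x : ℕ) ∈ S) h
    simpa [mem_valueSet, Fin.val_inj] using this
  · intro S hS
    rw [Finset.mem_powersetCard] at hS
    let e := S.orderEmbOfFin hS.2
    have he : ∀ k, e k ∈ S := fun k => S.orderEmbOfFin_mem hS.2 k
    refine ⟨OrderEmbedding.ofStrictMono
      (fun k => (⟨e k, Finset.mem_range.1 (hS.1 (he k))⟩ : Fin n))
      (fun k k' h => e.strictMono h), Finset.mem_univ _, ?_⟩
    ext j
    rw [mem_valueSet]
    have := S.range_orderEmbOfFin hS.2
    rw [← Finset.mem_coe, ← this]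
    rfl

/-- Such a set is `J` together with `ℓ - |J|` elements of `{i, …, n - 1}`. The guard matters: for
`|J| > ℓ` the truncated subtraction would give `1` instead of `0`. -/
theorem card_powersetCard_inter_eq {ℓ n i : ℕ} (hi : i ≤ n) {J : Finset ℕ}
    (hJ : J ⊆ Finset.range i) :
    ((Finset.powersetCard ℓ (Finset.range n)).filter fun S => S ∩ Finset.range i = J).card =
      if J.card ≤ ℓ then (n - i).choose (ℓ - J.card) else 0 := by
  split_ifs with h
  · have hc : (Finset.range n \ Finset.range i).card = n - i := by
      rw [Finset.card_sdiff_of_subset (Finset.range_mono hi), Finset.card_range, Finset.card_range]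
    rw [← hc, ← Finset.card_powersetCard]
    refine Finset.card_bij' (fun S _ => S \ Finset.range i) (fun D _ => D ∪ J) ?_ ?_ ?_ ?_
    · intro S hS
      simp only [Finset.mem_filter, Finset.mem_powersetCard] at hS ⊢
      obtain ⟨⟨h1, h2⟩, h3⟩ := hS
      refine ⟨Finset.sdiff_subset_sdiff h1 le_rfl, ?_⟩
      have := Finset.card_sdiff_add_card_inter S (Finset.range i)
      rw [h3] at this
      omega
    · intro D hD
      simp only [Finset.mem_filter, Finset.mem_powersetCard] at hD ⊢
      obtain ⟨h1, h2⟩ := hD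
      have hdisj : Disjoint D (Finset.range i) :=
        Finset.disjoint_of_subset_left h1 Finset.sdiff_disjoint
      refine ⟨⟨Finset.union_subset (h1.trans Finset.sdiff_subset)
        (hJ.trans (Finset.range_mono hi)), ?_⟩, ?_⟩
      · rw [Finset.card_union_of_disjoint (Finset.disjoint_of_subset_right hJ hdisj)]
        omega
      · rw [Finset.union_inter_distrib_right, Finset.disjoint_iff_inter_eq_empty.1 hdisj,
          Finset.empty_union, Finset.inter_eq_left.2 hJ]
    · intro S hS
      simp only [Finset.mem_filter] at hS
      rw [← hS.2, Finset.sdiff_union_inter]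
    · intro D hD
      simp only [Finset.mem_powersetCard] at hD
      have hdisj : Disjoint D (Finset.range i) :=
        Finset.disjoint_of_subset_left hD.1 Finset.sdiff_disjoint
      rw [Finset.union_sdiff_distrib, Finset.sdiff_eq_self_of_disjoint hdisj,
        Finset.sdiff_eq_empty_iff_subset.2 hJ, Finset.union_empty]
  · rw [Finset.card_eq_zero, Finset.filter_eq_empty_iff]
    intro S hS hSJ
    rw [Finset.mem_powersetCard] at hS
    apply h
    rw [← hSJ, ← hS.2]
    exact Finset.card_le_card Finset.inter_subset_left

/-- The signed count of pairs of `ℓ`-sets with the same trace on `{0, …, i - 1}`. -/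
theorem sum_powersetCard_inter_eq {n m ℓ i : ℕ} (hn : i ≤ n) (hm : i ≤ m) :
    (∑ S ∈ Finset.powersetCard ℓ (Finset.range n), ∑ T ∈ Finset.powersetCard ℓ (Finset.range m),
      if S ∩ Finset.range i = T ∩ Finset.range i then
        (-1 : ℤ) ^ (ℓ - (S ∩ Finset.range i).card) else 0) =
    ∑ k ∈ Finset.range (ℓ + 1),
      ((m - i).choose k : ℤ) * ((n - i).choose k : ℤ) * (i.choose (ℓ - k) : ℤ) * (-1) ^ k := by
  let g : ℕ → ℤ := fun j => if j ≤ ℓ then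
    ((m - i).choose (ℓ - j) : ℤ) * ((n - i).choose (ℓ - j) : ℤ) * (-1) ^ (ℓ - j) else 0
  have h1 : ∀ S T : Finset ℕ, (if S ∩ Finset.range i = T ∩ Finset.range i then
        (-1 : ℤ) ^ (ℓ - (S ∩ Finset.range i).card) else 0) =
      ∑ J ∈ (Finset.range i).powerset, (-1 : ℤ) ^ (ℓ - J.card) *
        (if S ∩ Finset.range i = J then 1 else 0) * (if T ∩ Finset.range i = J then 1 else 0) := by
    intro S T
    rw [Finset.sum_eq_single (S ∩ Finset.range i)]
    · simp [eq_comm]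
    · intro J _ hJ
      rw [if_neg hJ.symm, mul_zero, zero_mul]
    · intro h
      exact absurd (Finset.mem_powerset.2 Finset.inter_subset_right) h
  have h2 : ∀ J ∈ (Finset.range i).powerset,
      (∑ S ∈ Finset.powersetCard ℓ (Finset.range n), ∑ T ∈ Finset.powersetCard ℓ (Finset.range m),
        (-1 : ℤ) ^ (ℓ - J.card) * (if S ∩ Finset.range i = J then 1 else 0) *
          (if T ∩ Finset.range i = J then 1 else 0)) = g J.card := by
    intro J hJ
    rw [Finset.mem_powerset] at hJ
    simp only [← Finset.mul_sum, ← Finset.sum_mul, Finset.sum_boole,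
      card_powersetCard_inter_eq hn hJ, card_powersetCard_inter_eq hm hJ, g]
    split_ifs
    · ring
    · simp
  simp only [h1]
  rw [Finset.sum_congr rfl fun S _ => Finset.sum_comm, Finset.sum_comm, Finset.sum_congr rfl h2,
    Finset.sum_powerset_apply_card, Finset.card_range,
    ← Finset.sum_range_reflect _ (ℓ + 1)]
  -- With `j = |J|` and `k = ℓ - j`, one sum runs to `i` and the other to `ℓ`. Both extend to the
  -- larger bound, since the binomial vanishes beyond `i` and `g` beyond `ℓ`.
  have h3 : ∑ j ∈ Finset.range (i + 1), i.choose j • g j =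
      ∑ j ∈ Finset.range (max i ℓ + 1), i.choose j • g j := by
    refine Finset.sum_subset (Finset.range_mono (by omega)) fun j _ hj => ?_
    rw [Finset.mem_range, not_lt] at hj
    rw [Nat.choose_eq_zero_of_lt (by omega), zero_smul]
  have h4 : ∑ j ∈ Finset.range (ℓ + 1), i.choose j • g j =
      ∑ j ∈ Finset.range (max i ℓ + 1), i.choose j • g j := by
    refine Finset.sum_subset (Finset.range_mono (by omega)) fun j _ hj => ?_
    rw [Finset.mem_range, not_lt] at hj
    simp only [g]
    rw [if_neg (by omega), smul_zero]
  rw [h3, ← h4]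
  refine Finset.sum_congr rfl fun j hj => ?_
  rw [Finset.mem_range] at hj
  have e1 : ℓ + 1 - 1 - j = ℓ - j := by omega
  have e2 : ℓ - (ℓ - j) = j := by omega
  simp only [g]
  rw [if_pos (by omega), e1, e2, nsmul_eq_mul]
  ring

end Counting

/-! ### The copy of the Specht module and the eigenvalue of `η_ℓ` -/

section Main

variable {n m i N : ℕ}

/-- The bijection between the cells of `2^m 1^{n-m}` and those of `2^i 1^{n+m-2i}` moving the
bottom `m - i` cells of the second column below the first column. -/
def cellEquiv (hmn : m ≤ n) (hi : i ≤ m) :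
    {c : ℕ × ℕ // c ∈ (twoOne m (n - m)).cells} ≃
      {c : ℕ × ℕ // c ∈ (twoOne i (n + m - 2 * i)).cells} where
  toFun c := ⟨(if c.1.2 = 1 ∧ i ≤ c.1.1 then n + c.1.1 - i else c.1.1,
      if c.1.2 = 1 ∧ i ≤ c.1.1 then 0 else c.1.2), twoOne_mk_mem_cells (by
    have := twoOne_mem_cells c
    split_ifs <;> omega)⟩
  invFun c := ⟨(if c.1.2 = 0 ∧ n ≤ c.1.1 then c.1.1 + i - n else c.1.1,
      if c.1.2 = 0 ∧ n ≤ c.1.1 then 1 else c.1.2), twoOne_mk_mem_cells (by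
    have := twoOne_mem_cells c
    split_ifs <;> omega)⟩
  left_inv c := by
    have := twoOne_mem_cells c
    apply Subtype.ext
    apply Prod.ext <;> dsimp only <;> split_ifs <;> omega
  right_inv c := by
    have := twoOne_mem_cells c
    apply Subtype.ext
    apply Prod.ext <;> dsimp only <;> split_ifs <;> omega

theorem agrees_cellEquiv_trans (hmn : m ≤ n) (hi : i ≤ m)
    (t : Tableau (twoOne i (n + m - 2 * i)) N) : Agrees t ((cellEquiv hmn hi).trans t) := by
  intro z hz
  rw [symm_trans_apply]
  have : ¬ ((t.symm z).1.2 = 0 ∧ n ≤ (t.symm z).1.1) := by omega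
  apply Prod.ext
  · exact if_neg this
  · exact if_neg this

theorem eta_algebraAction_colSum_mul_rowSum (hmn : m ≤ n) (hi : i ≤ m) (ℓ : ℕ) {q' : ℕ}
    (t : Tableau (twoOne i q') N) {s₀ : Tableau (twoOne m (n - m)) N} (hs : Agrees t s₀) :
    eta m (n - m) N ℓ
      (algebraAction (twoOne m (n - m)) N (colSum t * rowSum t) (tabloid s₀)) =
    (omega n m ℓ i : ℂ) •
      algebraAction (twoOne m (n - m)) N (colSum t * rowSum t) (tabloid s₀) := by
  have hcount := sum_powersetCard_inter_eq (ℓ := ℓ) (hi.trans hmn) hi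
  have hsum : (∑ a : Fin ℓ ↪o Fin (m + (n - m)), ∑ b : Fin ℓ ↪o Fin m,
      if valueSet a ∩ Finset.range i = valueSet b ∩ Finset.range i then
        (-1 : ℂ) ^ (ℓ - (valueSet a ∩ Finset.range i).card) else 0) =
      ((∑ k ∈ Finset.range (ℓ + 1), ((m - i).choose k : ℤ) * ((n - i).choose k : ℤ) *
        (i.choose (ℓ - k) : ℤ) * (-1) ^ k : ℤ) : ℂ) := by
    rw [← hcount]
    simp only [Int.cast_sum, Int.cast_ite, Int.cast_pow, Int.cast_neg, Int.cast_one, Int.cast_zero]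
    rw [← sum_orderEmbedding_valueSet, Nat.add_sub_cancel' hmn]
    refine Finset.sum_congr rfl fun a _ => ?_
    rw [← sum_orderEmbedding_valueSet]
  rw [eta_algebraAction, eta_tabloid, etaTableau, map_sub, map_smul, map_sum, omega,
    Int.cast_sub, sub_smul, ← hsum, Finset.sum_smul, Int.cast_natCast]
  congr 1
  refine Finset.sum_congr rfl fun a _ => ?_
  rw [map_sum, Finset.sum_smul]
  exact Finset.sum_congr rfl fun b _ =>
    algebraAction_swapEntries t hs hi a.injective b.injective

/-- A subrepresentation isomorphic to the Specht module is generated by `aba[s₀]`. -/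
theorem mem_toSubmodule_iff {p q q' : ℕ} (t : Tableau (twoOne i q') N)
    {s₀ : Tableau (twoOne p q) N} (hs : Agrees t s₀)
    {W : Subrepresentation (columnTabloidRep (twoOne p q) N)}
    (e : W.toRepresentation.Equiv (specht t).toRepresentation) (v : ColumnTabloids (twoOne p q) N) :
    v ∈ W.toSubmodule ↔ ∃ x, v = algebraAction (twoOne p q) N x
      (algebraAction (twoOne p q) N (rowSum t)
        (algebraAction (twoOne p q) N (colSum t * rowSum t) (tabloid s₀))) := by
  let f : Representation.IntertwiningMap (specht t).toRepresentation
      (columnTabloidRep (twoOne p q) N) :=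
    (subrepresentationInclusion W).comp e.symm.toIntertwiningMap
  have hf : ∀ u, f u = (e.symm u : W.toSubmodule).1 := fun _ => rfl
  obtain ⟨c, hc⟩ := intertwiningMap_spechtGenerator t hs f
  have hc0 : c ≠ 0 := by
    rintro rfl
    rw [zero_smul, hf] at hc
    have h1 : e.symm (spechtGenerator t) = 0 := Subtype.ext hc
    exact spechtGenerator_ne_zero t ((EmbeddingLike.map_eq_zero_iff (f := e.symm)).1 h1)
  constructor
  · intro hv
    obtain ⟨y, hy⟩ := exists_eq_asAlgebraHom_spechtGenerator t (e ⟨v, hv⟩)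
    refine ⟨c • y, ?_⟩
    have hv' : v = f (e ⟨v, hv⟩) := by rw [hf, e.symm_apply_apply]
    rw [hv', hy, intertwiningMap_asAlgebraHom, hc, map_smul, map_smul, LinearMap.smul_apply]
  · rintro ⟨x, rfl⟩
    have h : f ((specht t).toRepresentation.asAlgebraHom (c⁻¹ • x) (spechtGenerator t)) ∈
        W.toSubmodule := by
      rw [hf]
      exact Subtype.property _
    rwa [intertwiningMap_asAlgebraHom, hc, map_smul, map_smul, LinearMap.smul_apply,
      smul_inv_smul₀ hc0] at h

/-- The copy is the image of `x ↦ x[s₀]` on the Specht module: this map is nonzero at `e_t`, so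
irreducibility makes it injective. -/
theorem exists_equiv_specht {p q q' : ℕ} (t : Tableau (twoOne i q') N)
    {s₀ : Tableau (twoOne p q) N} (hs : Agrees t s₀) :
    ∃ W : Subrepresentation (columnTabloidRep (twoOne p q) N),
      Nonempty (W.toRepresentation.Equiv (specht t).toRepresentation) := by
  let f : Representation.IntertwiningMap (specht t).toRepresentation
      (columnTabloidRep (twoOne p q) N) :=
    { toLinearMap := ((algebraAction (twoOne p q) N).toLinearMap.flip (tabloid s₀)).comp
        (specht t).toSubmodule.subtype
      isIntertwining' := fun g => LinearMap.ext fun v => by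
        change algebraAction (twoOne p q) N (MonoidAlgebra.of ℂ _ g * v.1) (tabloid s₀) = _
        rw [map_mul, Module.End.mul_apply, Representation.asAlgebraHom_of]
        rfl }
  have := specht_isIrreducible t
  have hinj : Function.Injective f := by
    refine (Representation.IsIrreducible.injective_or_eq_zero f).resolve_right fun h => ?_
    have h1 : f (spechtGenerator t) = 0 := by rw [h]; rfl
    apply algebraAction_symmetrizer_ne_zero t hs
    rw [← symmetrizer_eq]
    exact h1
  have hbij : Function.Bijective (f.toLinearMap.rangeRestrict) :=
    ⟨fun x y h => hinj (congrArg Subtype.val h), f.toLinearMap.surjective_rangeRestrict⟩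
  refine ⟨f.range, ⟨Representation.Equiv.symm (Representation.Equiv.mk
    (LinearEquiv.ofBijective _ hbij) fun g => LinearMap.ext fun v => Subtype.ext ?_)⟩⟩
  exact Representation.IntertwiningMap.isIntertwining _ _ f g v

end Main

end SpechtPres

end

/-- For `1 ≤ ℓ ≤ m ≤ n` and `i ≤ m`: the representation `M^μ` of `𝔖_{n+m}`, `μ = 2^m 1^{n-m}`, has
exactly one subrepresentation isomorphic to the Specht module of shape `2^i 1^{n+m-2i}`; it is
irreducible, and `η_ℓ` acts on it as the scalar `ω_{ℓ,i}`. -/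
theorem theorem3p3 (n m ℓ i : ℕ) (hm : 1 ≤ m) (hmn : m ≤ n) (hℓ : 1 ≤ ℓ) (hℓm : ℓ ≤ m)
    (hi : i ≤ m) (t : SpechtPres.Tableau (SpechtPres.twoOne i (n + m - 2 * i)) (n + m)) :
    (∃! W : Subrepresentation
        (SpechtPres.columnTabloidRep (SpechtPres.twoOne m (n - m)) (n + m)),
      Nonempty (W.toRepresentation.Equiv (SpechtPres.specht t).toRepresentation)) ∧
    ∀ W : Subrepresentation
        (SpechtPres.columnTabloidRep (SpechtPres.twoOne m (n - m)) (n + m)),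
      Nonempty (W.toRepresentation.Equiv (SpechtPres.specht t).toRepresentation) →
      W.toRepresentation.IsIrreducible ∧
      ∀ v ∈ W, SpechtPres.eta m (n - m) (n + m) ℓ v =
        (SpechtPres.omega n m ℓ i : ℂ) • v := by
  have hs := SpechtPres.agrees_cellEquiv_trans hmn hi t
  refine ⟨?_, ?_⟩
  · obtain ⟨W, hW⟩ := SpechtPres.exists_equiv_specht t hs
    refine ⟨W, hW, fun W' hW' => Subrepresentation.toSubmodule_injective ?_⟩
    obtain ⟨e⟩ := hW
    obtain ⟨e'⟩ := hW'
    -- Both submodules are generated by the same vector `aba[s₀]`, which does not depend on the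
    -- chosen isomorphism.
    ext v
    rw [SpechtPres.mem_toSubmodule_iff t hs e, SpechtPres.mem_toSubmodule_iff t hs e']
  · rintro W ⟨e⟩
    have := SpechtPres.specht_isIrreducible t
    refine ⟨SpechtPres.isIrreducible_of_equiv e, fun v hv => ?_⟩
    -- Every vector is `x a (ba[s₀])`; `η_ℓ` passes through `x` and `a` to the eigenvector `ba[s₀]`.
    obtain ⟨x, rfl⟩ := (SpechtPres.mem_toSubmodule_iff t hs e v).1 hv
    rw [SpechtPres.eta_algebraAction, SpechtPres.eta_algebraAction,
      SpechtPres.eta_algebraAction_colSum_mul_rowSum hmn hi ℓ t hs, map_smul, map_smul]
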